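/- **Setting.** Let $\Omega\subset\mathbb R^2$ be a bounded open set with $C^1$ boundary, $\mathcal H^1$ the one-dimensional Hausdorff measure, $\|\cdot\|$ the norm of $L^2(\Omega)$ or $L^2(\Omega;\mathbb R^2)$. For $v\in SBV(\Omega)$ let $\nabla v$ be its approximate gradient (the density of the absolutely continuous part of $Dv$) and $S(v)\subset\Omega$ its jump set (the set of points where $v$ has no approximate limit). For $S\subset\Omega$ with $\mathcal H^1(S)<+\infty$ let $SBV^2(\Omega,S)$ be the set of $v\in SBV(\Omega)\cap L^2(\Omega)$ with $\nabla v\in L^2(\Omega;\mathbb R^2)$ and $\mathcal H^1(S(v)\setminus S)=0$. Put $\mathcal F(v,S)=\|\nabla v\|^2+\mathcal H^1(S)$ and, for $u\in SBV^2(\Omega,S)$, $$|\partial\mathcal F|(u,S)=\limsup_{v\to u}\frac{(\mathcal F(u,S)-\mathcal F(v,S\cup S(v)))^+}{\|v-u\|},$$ where $v\in SBV(\Omega)$, $v\neq u$, tends to $u$ in $L^2(\Omega)$; $|\partial\mathcal F|_b(u,S)$ is defined by the same formula with $v$ restricted to the functions whose trace agrees with that of $u$ $\mathcal H^1$-a.e.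 on $\partial\Omega$. A sequence $S_k$ $\sigma^2$-converges to $S$ if $S_k,S\subset\Omega$, $\sup_k\mathcal H^1(S_k)<+\infty$, and: (a) if $k_j\to\infty$, $v_j\in SBV^2(\Omega,S_{k_j})$ is bounded in $L^\infty(\Omega)$, $w\in SBV(\Omega)$, $v_j\to w$ a.e. in $\Omega$ and $\nabla v_j\rightharpoonup\nabla w$ weakly in $L^2(\Omega;\mathbb R^2)$, then $w\in SBV^2(\Omega,S)\cap L^\infty(\Omega)$; (b) there are $w\in SBV^2(\Omega,S)\cap L^\infty(\Omega)$, with $S(w)=S$ up to an $\mathcal H^1$-null set, and $v_k\in SBV^2(\Omega,S_k)$, bounded in $L^\infty(\Omega)$, with $v_k\to w$ a.e. in $\Omega$ and $\nabla v_k\rightharpoonup\nabla w$ weakly in $L^2(\Omega;\mathbb R^2)$. The relaxed slopes $|\overline{\partial\mathcal F}|(u,S)$ and $|\overline{\partial\mathcal F}|_b(u,S)$ are the infima of $\liminf_k|\partial\mathcal F|(u_k,S_k)$ and of $\liminf_k|\partial\mathcal F|_b(u_k,S_k)$, respectively, over all sequences $(u_k,S_k)$ with $u_k\in SBV^2(\Omega,S_k)$,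 $u_k\to u$ strongly in $L^2(\Omega)$, $\nabla u_k\rightharpoonup\nabla u$ weakly in $L^2(\Omega;\mathbb R^2)$ and $S_k$ $\sigma^2$-converging to $S$. **Proposition.** Let $S\subset\Omega$ with $\mathcal H^1(S)<+\infty$ and let $u\in SBV^2(\Omega,S)$. If $|\overline{\partial\mathcal F}|_b(u,S)<+\infty$, then there exists $f\in L^2(\Omega)$ such that $$-\operatorname{div}(\nabla u)=f\quad\text{in }\mathcal D'(\Omega),\qquad |\nabla u|^2-\operatorname{div}(u\nabla u)\le fu\quad\text{in }\mathcal D'(\Omega),$$ and $2\|f\|\le|\overline{\partial\mathcal F}|_b(u,S)$. If, in addition, $|\overline{\partial\mathcal F}|(u,S)<+\infty$, then the same $f$ satisfies $$-\operatorname{div}(\nabla\tilde u)=\tilde f\quad\text{in }\mathcal D'(\mathbb R^2),$$ where $\tilde u$, $\tilde f$ are the extensions of $u$, $f$ by zero to $\mathbb R^2$ and $\nabla\tilde u$ is $\nabla u$ in $\Omega$ and $0$ in $\mathbb R^2\setminus\Omega$ (almost everywhere). -/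

import Mathlib

open MeasureTheory Filter Topology Set
open scoped ENNReal NNReal RealInnerProductSpace

namespace MumfordShah

/-- The Euclidean plane `ℝ²`. -/
abbrev Plane : Type := EuclideanSpace ℝ (Fin 2)

/-- `Ω` has a `C¹` boundary: near each boundary point, `Ω` is the strict sublevel set `{g < 0}` of
a `C¹` function `g` whose differential does not vanish at that point. -/
def HasC1Boundary (Ω : Set Plane) : Prop :=
  ∀ x ∈ frontier Ω, ∃ (U : Set Plane) (g : Plane → ℝ), IsOpen U ∧ x ∈ U ∧
    ContDiffOn ℝ 1 g U ∧ fderiv ℝ g x ≠ 0 ∧ Ω ∩ U = {y ∈ U | g y < 0}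

/-- `φ ∈ C_c^∞(U)`. -/
structure IsTestFunction (U : Set Plane) (φ : Plane → ℝ) : Prop where
  smooth : ContDiff ℝ (⊤ : ℕ∞) φ
  compactSupport : HasCompactSupport φ
  support_subset : tsupport φ ⊆ U

/-- `⨍_{B_r(x) ∩ Ω} |u - z| → 0` as `r → 0+`. For `x ∈ Ω` this says that `z` is the approximate
limit of `u` at `x`; for `x ∈ ∂Ω` it says that `z` is the trace of `u` at `x`. -/
def HasApproxLimit (Ω : Set Plane) (u : Plane → ℝ) (x : Plane) (z : ℝ) : Prop :=
  Tendsto (fun r : ℝ => ⨍⁻ y in Metric.ball x r ∩ Ω, ‖u y - z‖ₑ ∂volume) (𝓝[>] 0) (𝓝 0)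

/-- `S(u)`: the points of `Ω` at which `u` has no approximate limit. -/
def jumpSet (Ω : Set Plane) (u : Plane → ℝ) : Set Plane :=
  {x ∈ Ω | ¬ ∃ z : ℝ, HasApproxLimit Ω u x z}

open Classical in
/-- The trace of `u` on `∂Ω` (for `u ∈ BV(Ω)` and `Ω` with `C¹` boundary it exists at
`ℋ¹`-a.e. point of `∂Ω`; the value is `0` where it does not exist). -/
noncomputable def bdryTrace (Ω : Set Plane) (u : Plane → ℝ) (x : Plane) : ℝ :=
  if h : ∃ z : ℝ, HasApproxLimit Ω u x z then h.choose else 0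

/-- `v = u` on `∂Ω`: the traces agree `ℋ¹`-a.e. on `∂Ω`. -/
def EqOnBoundary (Ω : Set Plane) (v u : Plane → ℝ) : Prop :=
  ∀ᵐ x ∂((Measure.hausdorffMeasure 1 : Measure Plane).restrict (frontier Ω)),
    bdryTrace Ω v x = bdryTrace Ω u x

/-- `u ∈ BV(Ω)`, and `Du = g ℒ² + σ μ` is the Lebesgue decomposition of its distributional
derivative, the singular part being written in polar form (so that `μ = |Dˢu|`). -/
structure HasBVDerivative (Ω : Set Plane) (u : Plane → ℝ) (g σ : Plane → Plane)
    (μ : Measure Plane) : Prop where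
  integrable : IntegrableOn u Ω
  integrable_density : IntegrableOn g Ω
  finite : IsFiniteMeasure μ
  carried : μ Ωᶜ = 0
  singular : μ ⟂ₘ (volume : Measure Plane)
  polar_measurable : AEStronglyMeasurable σ μ
  polar_norm : ∀ᵐ x ∂μ, ‖σ x‖ = 1
  integral_eq : ∀ φ : Plane → ℝ, IsTestFunction Ω φ →
    ∫ x in Ω, u x • gradient φ x = -((∫ x in Ω, φ x • g x) + ∫ x, φ x • σ x ∂μ)

/-- `u ∈ SBV(Ω)`: `u ∈ BV(Ω)` and the Cantor part `Dˢu ⌊ (Ω \ S(u))` of `Du` vanishes. -/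
def IsSBV (Ω : Set Plane) (u : Plane → ℝ) : Prop :=
  ∃ (g σ : Plane → Plane) (μ : Measure Plane),
    HasBVDerivative Ω u g σ μ ∧ μ (Ω \ jumpSet Ω u) = 0

open Classical in
/-- The approximate gradient `∇u` of `u ∈ BV(Ω)`, i.e. the density of the absolutely continuous
part of `Du`. It is determined a.e. in `Ω`. -/
noncomputable def approxGrad (Ω : Set Plane) (u : Plane → ℝ) : Plane → Plane :=
  if h : ∃ (g σ : Plane → Plane) (μ : Measure Plane), HasBVDerivative Ω u g σ μ then h.choose
  else 0

/-- `A ⊆ B` up to an `ℋ¹`-negligible set. -/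
def SubsetH1 (A B : Set Plane) : Prop :=
  (Measure.hausdorffMeasure 1 : Measure Plane) (A \ B) = 0

/-- `u ∈ SBV²(Ω, S)`. -/
structure IsSBV2 (Ω S : Set Plane) (u : Plane → ℝ) : Prop where
  sbv : IsSBV Ω u
  memLp : MemLp u 2 (volume.restrict Ω)
  memLp_grad : MemLp (approxGrad Ω u) 2 (volume.restrict Ω)
  jumpSet_subset : SubsetH1 (jumpSet Ω u) S

/-- The `L²(Ω)` norm. -/
noncomputable def normL2 {F : Type*} [NormedAddCommGroup F] (Ω : Set Plane) (h : Plane → F) :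
    ℝ≥0∞ :=
  eLpNorm h 2 (volume.restrict Ω)

/-- The Mumford–Shah functional `ℱ(u, S) = ‖∇u‖² + ℋ¹(S)`, with values in `[0, +∞]`. -/
noncomputable def energy (Ω : Set Plane) (u : Plane → ℝ) (S : Set Plane) : ℝ≥0∞ :=
  normL2 Ω (approxGrad Ω u) ^ 2 + (Measure.hausdorffMeasure 1 : Measure Plane) S

/-- The quotient `(ℱ(u, S) - ℱ(v, S ∪ S(v)))⁺ / ‖v - u‖`; the truncated subtraction of `[0, +∞]`
is the positive part of the difference, as `ℱ(u, S)` is finite for `u ∈ SBV²(Ω, S)`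
and `ℋ¹(S) < +∞`. -/
noncomputable def slopeQuotient (Ω : Set Plane) (u : Plane → ℝ) (S : Set Plane)
    (v : Plane → ℝ) : ℝ≥0∞ :=
  (energy Ω u S - energy Ω v (S ∪ jumpSet Ω v)) / normL2 Ω (v - u)

/-- The filter `v → u` in `L²(Ω)`, `v ≠ u`. -/
noncomputable def puncturedL2 (Ω : Set Plane) (u : Plane → ℝ) : Filter (Plane → ℝ) :=
  comap (fun v => normL2 Ω (v - u)) (𝓝[>] 0)

/-- The unilateral slope `|∂ℱ|(u, S)`. -/
noncomputable def unilateralSlope (Ω : Set Plane) (u : Plane → ℝ) (S : Set Plane) : ℝ≥0∞ :=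
  limsup (slopeQuotient Ω u S) (puncturedL2 Ω u ⊓ 𝓟 {v | IsSBV Ω v})

/-- The unilateral slope `|∂ℱ|_b(u, S)` with fixed boundary conditions. -/
noncomputable def unilateralSlopeB (Ω : Set Plane) (u : Plane → ℝ) (S : Set Plane) : ℝ≥0∞ :=
  limsup (slopeQuotient Ω u S)
    (puncturedL2 Ω u ⊓ 𝓟 {v | IsSBV Ω v ∧ EqOnBoundary Ω v u})

/-- `G k ⇀ G'` weakly in `L²(Ω; ℝ²)`. -/
structure WeakConvL2 (Ω : Set Plane) (G : ℕ → Plane → Plane) (G' : Plane → Plane) : Prop where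
  memLp : ∀ k, MemLp (G k) 2 (volume.restrict Ω)
  memLp_limit : MemLp G' 2 (volume.restrict Ω)
  tendsto : ∀ h : Plane → Plane, MemLp h 2 (volume.restrict Ω) →
    Tendsto (fun k => ∫ x in Ω, ⟪G k x, h x⟫) atTop (𝓝 (∫ x in Ω, ⟪G' x, h x⟫))

/-- The sequence `v` is bounded in `L^∞(Ω)`, `v k → w` a.e. in `Ω`, and `∇(v k) ⇀ ∇w` weakly in
`L²(Ω; ℝ²)`. -/
structure BoundedConv (Ω : Set Plane) (v : ℕ → Plane → ℝ) (w : Plane → ℝ) : Prop where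
  bounded : ∃ C : ℝ, ∀ k, ∀ᵐ x ∂(volume.restrict Ω), |v k x| ≤ C
  ae_tendsto : ∀ᵐ x ∂(volume.restrict Ω), Tendsto (fun k => v k x) atTop (𝓝 (w x))
  weak_grad : WeakConvL2 Ω (fun k => approxGrad Ω (v k)) (approxGrad Ω w)

/-- `Sk` `σ²`-converges to `S`. In the closure condition the limit `w` is taken in `SBV(Ω)`, so
that `∇w` is meaningful. -/
structure Sigma2Converges (Ω : Set Plane) (Sk : ℕ → Set Plane) (S : Set Plane) : Prop where
  subset : ∀ k, Sk k ⊆ Ω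
  subset_limit : S ⊆ Ω
  bounded : ∃ C : ℝ≥0, ∀ k, (Measure.hausdorffMeasure 1 : Measure Plane) (Sk k) ≤ C
  closed : ∀ (κ : ℕ → ℕ) (v : ℕ → Plane → ℝ) (w : Plane → ℝ), Tendsto κ atTop atTop →
    (∀ j, IsSBV2 Ω (Sk (κ j)) (v j)) → IsSBV Ω w → BoundedConv Ω v w →
    IsSBV2 Ω S w ∧ MemLp w ⊤ (volume.restrict Ω)
  recovery : ∃ (w : Plane → ℝ) (v : ℕ → Plane → ℝ),
    IsSBV2 Ω S w ∧ MemLp w ⊤ (volume.restrict Ω) ∧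
    SubsetH1 (jumpSet Ω w) S ∧ SubsetH1 S (jumpSet Ω w) ∧
    (∀ k, IsSBV2 Ω (Sk k) (v k)) ∧ BoundedConv Ω v w

/-- The sequences `(uk, Sk)` admitted in the definition of the relaxed slopes at `(u, S)`. -/
structure AdmissibleSequence (Ω : Set Plane) (u : Plane → ℝ) (S : Set Plane)
    (uk : ℕ → Plane → ℝ) (Sk : ℕ → Set Plane) : Prop where
  sbv2 : ∀ k, IsSBV2 Ω (Sk k) (uk k)
  strong : Tendsto (fun k => normL2 Ω (uk k - u)) atTop (𝓝 0)
  weak_grad : WeakConvL2 Ω (fun k => approxGrad Ω (uk k)) (approxGrad Ω u)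
  sigma2 : Sigma2Converges Ω Sk S

/-- The relaxed slope, the lower semicontinuous envelope of `|∂ℱ|`. -/
noncomputable def relaxedSlope (Ω : Set Plane) (u : Plane → ℝ) (S : Set Plane) : ℝ≥0∞ :=
  ⨅ (uk : ℕ → Plane → ℝ) (Sk : ℕ → Set Plane) (_ : AdmissibleSequence Ω u S uk Sk),
    liminf (fun k => unilateralSlope Ω (uk k) (Sk k)) atTop

/-- The relaxed slope with boundary conditions, the lower semicontinuous envelope of `|∂ℱ|_b`. -/
noncomputable def relaxedSlopeB (Ω : Set Plane) (u : Plane → ℝ) (S : Set Plane) : ℝ≥0∞ :=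
  ⨅ (uk : ℕ → Plane → ℝ) (Sk : ℕ → Set Plane) (_ : AdmissibleSequence Ω u S uk Sk),
    liminf (fun k => unilateralSlopeB Ω (uk k) (Sk k)) atTop

/-- `-div G = f` in `𝒟'(U)`. -/
def NegDivEq (U : Set Plane) (G : Plane → Plane) (f : Plane → ℝ) : Prop :=
  ∀ φ : Plane → ℝ, IsTestFunction U φ →
    ∫ x in U, ⟪G x, gradient φ x⟫ = ∫ x in U, f x * φ x

/-- `a - div G ≤ b` in `𝒟'(U)`. -/
def SubDivLe (U : Set Plane) (a : Plane → ℝ) (G : Plane → Plane) (b : Plane → ℝ) : Prop :=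
  ∀ φ : Plane → ℝ, IsTestFunction U φ → (∀ x, 0 ≤ φ x) →
    (∫ x in U, a x * φ x) + (∫ x in U, ⟪G x, gradient φ x⟫) ≤ ∫ x in U, b x * φ x

end MumfordShah

open MumfordShah

/-! The slope is tested along the curves v = u + ε(φu + η) with φ, η smooth and compactly supported.
For small ε > 0 the factor 1 + εφ is positive, so v and u have the same jump set: the length term
does not increase and the variation of the energy comes from the gradient alone. With w = φ∇u + u∇φ
+ ∇η, letting ε → 0 gives -2∫∇u·w ≤ |∂ℱ|(u,S) ‖φu + η‖ (`neg_two_mul_integral_le_of_limsup_le`). If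
φ and η are supported in Ω, then v = u near ∂Ω and the same bound holds for |∂ℱ|_b.

Taking φ = 0 along an admissible sequence, the left side is linear in ∇u_k and passes to the weak
limit. Hence η ↦ ∫∇u·∇η is bounded in L² by half the relaxed slope, and Riesz representation yields
f with its norm bound.

Taking -φ with φ ≥ 0, the term ∫φ|∇u_k|² is only lower semicontinuous, in the favourable direction;
it is linearized at ∇u (`integral_inner_linearizedField_sub_le`). In the limit ∫φ|∇u|² + u∇u·∇φ ≤
∫fη + (M/2)‖η - φu‖ for every test function η, and η → φu in L² gives the differential inequality.

For the slope without boundary condition, η need not vanish near ∂Ω. Riesz representation then works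
with test functions on the whole plane, and the resulting function agrees with f because both
represent the same functional on functions supported in Ω. -/

namespace MumfordShah

/-! ### Calculus of test functions. -/

namespace IsTestFunction

variable {U : Set Plane} {φ ψ : Plane → ℝ}

theorem differentiable (h : IsTestFunction U φ) : Differentiable ℝ φ :=
  h.smooth.differentiable (by simp)

theorem continuous (h : IsTestFunction U φ) : Continuous φ :=
  h.smooth.continuous

theorem mono {V : Set Plane} (h : IsTestFunction U φ) (hUV : U ⊆ V) : IsTestFunction V φ :=
  ⟨h.smooth, h.compactSupport, h.support_subset.trans hUV⟩

theorem continuous_gradient (h : IsTestFunction U φ) : Continuous (gradient φ) :=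
  (InnerProductSpace.toDual ℝ Plane).symm.continuous.comp
    (h.smooth.continuous_fderiv (by simp))

theorem hasCompactSupport_gradient (h : IsTestFunction U φ) : HasCompactSupport (gradient φ) :=
  (h.compactSupport.fderiv ℝ).comp_left (map_zero (InnerProductSpace.toDual ℝ Plane).symm)

theorem eq_zero_of_notMem (h : IsTestFunction U φ) {x : Plane} (hx : x ∉ U) : φ x = 0 :=
  image_eq_zero_of_notMem_tsupport fun h' => hx (h.support_subset h')

theorem gradient_eq_zero_of_notMem (h : IsTestFunction U φ) {x : Plane} (hx : x ∉ U) :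
    gradient φ x = 0 := by
  have : fderiv ℝ φ x = 0 :=
    image_eq_zero_of_notMem_tsupport fun h' => hx (h.support_subset (tsupport_fderiv_subset ℝ h'))
  simp [gradient, this]

theorem exists_bound (h : IsTestFunction U φ) : ∃ C, 0 ≤ C ∧ ∀ x, |φ x| ≤ C := by
  obtain ⟨C, hC⟩ := h.compactSupport.exists_bound_of_continuous h.continuous
  exact ⟨C, (norm_nonneg _).trans (hC 0), hC⟩

theorem exists_bound_gradient (h : IsTestFunction U φ) :
    ∃ C, 0 ≤ C ∧ ∀ x, ‖gradient φ x‖ ≤ C := by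
  obtain ⟨C, hC⟩ := h.hasCompactSupport_gradient.exists_bound_of_continuous h.continuous_gradient
  exact ⟨C, (norm_nonneg _).trans (hC 0), hC⟩

theorem zero : IsTestFunction U (fun _ => 0) :=
  ⟨contDiff_const, HasCompactSupport.zero, by simp [tsupport]⟩

theorem add (h : IsTestFunction U φ) (h' : IsTestFunction U ψ) :
    IsTestFunction U (fun x => φ x + ψ x) :=
  ⟨h.smooth.add h'.smooth, h.compactSupport.add h'.compactSupport,
    (tsupport_add φ ψ).trans (union_subset h.support_subset h'.support_subset)⟩

theorem mul_left {a : Plane → ℝ} (ha : ContDiff ℝ (⊤ : ℕ∞) a) (h : IsTestFunction U φ) :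
    IsTestFunction U (fun x => a x * φ x) :=
  ⟨ha.mul h.smooth, h.compactSupport.mul_left, (tsupport_mul_subset_right).trans h.support_subset⟩

theorem const_mul (c : ℝ) (h : IsTestFunction U φ) : IsTestFunction U (fun x => c * φ x) :=
  h.mul_left contDiff_const

theorem memLp (h : IsTestFunction U φ) (Ω : Set Plane) (p : ℝ≥0∞) :
    MemLp φ p (volume.restrict Ω) :=
  (h.continuous.memLp_of_hasCompactSupport h.compactSupport).restrict Ω

theorem memLp_gradient (h : IsTestFunction U φ) (Ω : Set Plane) (p : ℝ≥0∞) :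
    MemLp (gradient φ) p (volume.restrict Ω) :=
  (h.continuous_gradient.memLp_of_hasCompactSupport h.hasCompactSupport_gradient).restrict Ω

end IsTestFunction

theorem gradient_add_apply {a b : Plane → ℝ} {x : Plane} (ha : DifferentiableAt ℝ a x)
    (hb : DifferentiableAt ℝ b x) :
    gradient (fun y => a y + b y) x = gradient a x + gradient b x := by
  simp [gradient, fderiv_fun_add ha hb]

theorem gradient_mul_apply {a b : Plane → ℝ} {x : Plane} (ha : DifferentiableAt ℝ a x)
    (hb : DifferentiableAt ℝ b x) :
    gradient (fun y => a y * b y) x = a x • gradient b x + b x • gradient a x := by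
  simp [gradient, fderiv_fun_mul ha hb]

theorem gradient_const_mul_apply {a : Plane → ℝ} {x : Plane} (c : ℝ) (ha : DifferentiableAt ℝ a x) :
    gradient (fun y => c * a y) x = c • gradient a x := by
  simp [gradient, fderiv_const_mul ha]

/-- No boundary term appears, although φ may be nonzero on ∂Ω: ψ is compactly supported in Ω, so
both integrals extend to the plane. -/
theorem IsTestFunction.integral_smul_gradient {Ω : Set Plane} {φ ψ : Plane → ℝ}
    (hφ : IsTestFunction univ φ) (hψ : IsTestFunction Ω ψ) :
    ∫ x in Ω, φ x • gradient ψ x = -∫ x in Ω, ψ x • gradient φ x := by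
  rw [setIntegral_eq_integral_of_forall_compl_eq_zero
      (fun x hx => by rw [hψ.gradient_eq_zero_of_notMem hx, smul_zero]),
    setIntegral_eq_integral_of_forall_compl_eq_zero
      (fun x hx => by rw [hψ.eq_zero_of_notMem hx, zero_smul])]
  have i1 : Integrable (fun x => φ x • gradient ψ x) (volume : Measure Plane) :=
    (hφ.continuous.smul hψ.continuous_gradient).integrable_of_hasCompactSupport
      hψ.hasCompactSupport_gradient.smul_left
  have i2 : Integrable (fun x => ψ x • gradient φ x) (volume : Measure Plane) :=
    (hψ.continuous.smul hφ.continuous_gradient).integrable_of_hasCompactSupport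
      hψ.compactSupport.smul_right
  have i3 : Integrable (fun x => φ x * ψ x) (volume : Measure Plane) :=
    (hφ.continuous.mul hψ.continuous).integrable_of_hasCompactSupport hψ.compactSupport.mul_left
  refine ext_inner_right ℝ fun v => ?_
  rw [inner_neg_left, real_inner_comm, ← integral_inner i1, real_inner_comm, ← integral_inner i2]
  have e1 : ∀ x, ⟪v, φ x • gradient ψ x⟫ = φ x * fderiv ℝ ψ x v := fun x => by
    rw [inner_smul_right, real_inner_comm, inner_gradient_left]
  have e2 : ∀ x, ⟪v, ψ x • gradient φ x⟫ = fderiv ℝ φ x v * ψ x := fun x => by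
    rw [inner_smul_right, real_inner_comm, inner_gradient_left, mul_comm]
  simp only [e1, e2]
  refine integral_mul_fderiv_eq_neg_fderiv_mul_of_integrable ?_ ?_ i3
    (fun x _ => hφ.differentiable x) (fun x _ => hψ.differentiable x)
  · simpa only [e2] using i2.const_inner (𝕜 := ℝ) v
  · simpa only [e1] using i1.const_inner (𝕜 := ℝ) v

/-! ### Uniqueness of the approximate gradient. -/

section Uniqueness

variable {Ω : Set Plane} {u v : Plane → ℝ} {g₁ g₂ σ₁ σ₂ : Plane → Plane} {μ₁ μ₂ : Measure Plane}

theorem HasBVDerivative.integrable_polar {σ : Plane → Plane} {μ : Measure Plane}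
    {g : Plane → Plane} (h : HasBVDerivative Ω u g σ μ) : Integrable σ μ := by
  have := h.finite
  refine (integrable_const (1 : ℝ)).mono' h.polar_measurable ?_
  filter_upwards [h.polar_norm] with x hx using hx.le

/-- The absolutely continuous part of the distributional derivative is unique. -/
theorem HasBVDerivative.density_ae_eq (hΩ : IsOpen Ω) (h₁ : HasBVDerivative Ω u g₁ σ₁ μ₁)
    (h₂ : HasBVDerivative Ω v g₂ σ₂ μ₂) (huv : u =ᵐ[volume.restrict Ω] v) :
    g₁ =ᵐ[volume.restrict Ω] g₂ := by
  have := h₁.finite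
  have := h₂.finite
  set l : Measure Plane := μ₁ + μ₂ with hl
  have : IsFiniteMeasure l := by rw [hl]; infer_instance
  have : SigmaFinite l := IsFiniteMeasure.toSigmaFinite l
  have : SigmaFinite μ₁ := IsFiniteMeasure.toSigmaFinite μ₁
  have : SigmaFinite μ₂ := IsFiniteMeasure.toSigmaFinite μ₂
  have ac₁ : μ₁ ≪ l := (Measure.le_add_right le_rfl).absolutelyContinuous
  have ac₂ : μ₂ ≪ l := (Measure.le_add_left le_rfl).absolutelyContinuous
  have sing : l ⟂ₘ (volume : Measure Plane) := h₁.singular.add_left h₂.singular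
  obtain ⟨s, hs, hls, hvs⟩ := sing
  set G : Plane → Plane := fun x => g₁ x - g₂ x
  set H : Plane → Plane := fun x => (μ₁.rnDeriv l x).toReal • σ₁ x - (μ₂.rnDeriv l x).toReal • σ₂ x
  have iG : Integrable G (volume.restrict Ω) := h₁.integrable_density.sub h₂.integrable_density
  have iH₁ := (integrable_rnDeriv_smul_iff ac₁).2 h₁.integrable_polar
  have iH₂ := (integrable_rnDeriv_smul_iff ac₂).2 h₂.integrable_polar
  have iH : Integrable H l := iH₁.sub iH₂
  classical
  -- Since `l` vanishes on `s` and Lebesgue measure off `s`, `F` carries both differences at once: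
  -- absolutely continuous parts on `s`, singular parts off it. One application of the fundamental
  -- lemma to `volume.restrict Ω + l` then suffices.
  set F : Plane → Plane := s.piecewise G H
  have eG : F =ᵐ[volume.restrict Ω] G := by
    have : ∀ᵐ x ∂(volume.restrict Ω), x ∈ s := ae_restrict_of_ae hvs
    filter_upwards [this] with x hx using piecewise_eq_of_mem _ _ _ hx
  have eH : F =ᵐ[l] H := by
    have : ∀ᵐ x ∂l, x ∉ s := measure_eq_zero_iff_ae_notMem.1 hls
    filter_upwards [this] with x hx using piecewise_eq_of_notMem _ _ _ hx
  have iFG : Integrable F (volume.restrict Ω) := iG.congr eG.symm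
  have iFH : Integrable F l := iH.congr eH.symm
  have iF : Integrable F (volume.restrict Ω + l) := iFG.add_measure iFH
  have key : ∀ᵐ x ∂(volume.restrict Ω + l), x ∈ Ω → F x = 0 := by
    refine hΩ.ae_eq_zero_of_integral_contDiff_smul_eq_zero
      (iF.locallyIntegrable.locallyIntegrableOn Ω) fun φ h1 h2 h3 => ?_
    have hφ : IsTestFunction Ω φ := ⟨h1, h2, h3⟩
    obtain ⟨C, -, hC⟩ := hφ.exists_bound
    have bd : ∀ {ν : Measure Plane} {f : Plane → Plane}, Integrable f ν →
        Integrable (fun x => φ x • f x) ν := fun {ν f} hf =>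
      hf.bdd_smul C hφ.continuous.aestronglyMeasurable (ae_of_all _ hC)
    rw [integral_add_measure (bd iFG) (bd iFH)]
    have r1 : ∫ x in Ω, φ x • F x = (∫ x in Ω, φ x • g₁ x) - ∫ x in Ω, φ x • g₂ x := by
      rw [← integral_sub (bd h₁.integrable_density) (bd h₂.integrable_density)]
      refine integral_congr_ae ?_
      filter_upwards [eG] with x hx
      rw [hx, smul_sub]
    have r2 : ∫ x, φ x • F x ∂l = (∫ x, φ x • σ₁ x ∂μ₁) - ∫ x, φ x • σ₂ x ∂μ₂ := by
      rw [← integral_rnDeriv_smul ac₁, ← integral_rnDeriv_smul ac₂,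
        ← integral_sub ((integrable_rnDeriv_smul_iff ac₁).2 (bd h₁.integrable_polar))
          ((integrable_rnDeriv_smul_iff ac₂).2 (bd h₂.integrable_polar))]
      refine integral_congr_ae ?_
      filter_upwards [eH] with x hx
      rw [hx, smul_sub, smul_comm, smul_comm (φ x)]
    have e₁ := h₁.integral_eq φ hφ
    have e₂ := h₂.integral_eq φ hφ
    have e₃ : ∫ x in Ω, u x • gradient φ x = ∫ x in Ω, v x • gradient φ x := by
      refine integral_congr_ae ?_
      filter_upwards [huv] with x hx
      rw [hx]
    rw [e₁, e₂, neg_inj] at e₃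
    rw [r1, r2, sub_add_sub_comm, e₃, sub_self]
  have key' : ∀ᵐ x ∂(volume.restrict Ω), x ∈ Ω → F x = 0 :=
    (ae_add_measure_iff.1 key).1
  filter_upwards [key', eG, ae_restrict_mem hΩ.measurableSet] with x h1 h2 h3
  exact sub_eq_zero.1 (h2.symm.trans (h1 h3))

end Uniqueness

/-! ### Perturbations (1 + φ)u + η: derivative, jump set and trace. -/

section Perturbation

variable {Ω : Set Plane} {u φ η : Plane → ℝ}

/-- The perturbation `(1 + φ) u + η` of `u`. -/
def perturb (u φ η : Plane → ℝ) : Plane → ℝ := fun x => (1 + φ x) * u x + η x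

/-- The gradient of `φ u + η`, when `u` has gradient `g`. -/
noncomputable def incrementGrad (u : Plane → ℝ) (g : Plane → Plane) (φ η : Plane → ℝ) :
    Plane → Plane :=
  fun x => φ x • g x + u x • gradient φ x + gradient η x

/-- Leibniz rule, obtained by testing Du with (1 + φ)ψ. As 1 + φ is positive, the polar direction of
the singular part is kept and the factor becomes a density of its measure. -/
theorem HasBVDerivative.perturb {g σ : Plane → Plane} {μ : Measure Plane}
    (h : HasBVDerivative Ω u g σ μ) (hφ : IsTestFunction univ φ) (hη : IsTestFunction univ η)
    (hpos : ∀ x, 0 < 1 + φ x) :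
    HasBVDerivative Ω (perturb u φ η) (fun x => g x + incrementGrad u g φ η x) σ
      (μ.withDensity fun x => ENNReal.ofReal (1 + φ x)) := by
  have := h.finite
  obtain ⟨C, -, hC⟩ := hφ.exists_bound
  have ca : Continuous fun x => 1 + φ x := continuous_const.add hφ.continuous
  have ha : ∀ x, ‖1 + φ x‖ ≤ 1 + C := fun x => by
    simpa using (norm_add_le (1 : ℝ) (φ x)).trans (by simpa using hC x)
  have ac : (μ.withDensity fun x => ENNReal.ofReal (1 + φ x)) ≪ μ :=
    withDensity_absolutelyContinuous _ _
  have bd : ∀ {F : Type} [NormedAddCommGroup F] [NormedSpace ℝ F] {ψ : Plane → ℝ}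
      {ν : Measure Plane} {f : Plane → F}, IsTestFunction univ ψ →
      Integrable f ν → Integrable (fun x => ψ x • f x) ν := by
    intro F _ _ ψ ν f hψ hf
    obtain ⟨D, -, hD⟩ := hψ.exists_bound
    exact hf.bdd_smul D hψ.continuous.aestronglyMeasurable (ae_of_all _ hD)
  have iug : Integrable (fun x => u x • gradient φ x) (volume.restrict Ω) := by
    obtain ⟨D, -, hD⟩ := hφ.exists_bound_gradient
    exact h.integrable.smul_bdd D hφ.continuous_gradient.aestronglyMeasurable (ae_of_all _ hD)
  have iη : Integrable (gradient η) (volume.restrict Ω) :=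
    memLp_one_iff_integrable.1 (hη.memLp_gradient Ω 1)
  refine ⟨?_, ?_, ?_, ?_, ?_, ?_, ?_, ?_⟩
  · have i1 : Integrable (fun x => (1 + φ x) • u x) (volume.restrict Ω) :=
      h.integrable.bdd_smul (1 + C) ca.aestronglyMeasurable (ae_of_all _ ha)
    exact i1.add (memLp_one_iff_integrable.1 (hη.memLp Ω 1))
  · exact h.integrable_density.add (((bd hφ h.integrable_density).add iug).add iη)
  · exact isFiniteMeasure_withDensity_ofReal
      ((integrable_const (1 + C)).mono' ca.aestronglyMeasurable (ae_of_all _ ha)).2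
  · exact ac h.carried
  · exact h.singular.mono_ac ac Measure.AbsolutelyContinuous.rfl
  · exact h.polar_measurable.mono_ac ac
  · exact ac.ae_le h.polar_norm
  · intro ψ hψ
    have hψ' := hψ.mono (subset_univ Ω)
    have hχ : IsTestFunction Ω (fun x => (1 + φ x) * ψ x) :=
      hψ.mul_left (contDiff_const.add hφ.smooth)
    have hχ' := hχ.mono (subset_univ Ω)
    have gχ : ∀ x, gradient (fun y => (1 + φ y) * ψ y) x
        = (1 + φ x) • gradient ψ x + ψ x • gradient φ x := fun x => by
      rw [gradient_mul_apply ((hφ.differentiable x).const_add 1) (hψ.differentiable x)]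
      have : gradient (fun y => 1 + φ y) x = gradient φ x := by
        simp [gradient, fderiv_const_add]
      rw [this]
    have iuχ : Integrable (fun x => u x • gradient (fun y => (1 + φ y) * ψ y) x)
        (volume.restrict Ω) := by
      obtain ⟨D, -, hD⟩ := hχ.exists_bound_gradient
      exact h.integrable.smul_bdd D hχ.continuous_gradient.aestronglyMeasurable (ae_of_all _ hD)
    have iηψ : Integrable (fun x => η x • gradient ψ x) (volume.restrict Ω) :=
      bd hη (memLp_one_iff_integrable.1 (hψ.memLp_gradient Ω 1))
    have e1 : ∫ x in Ω, MumfordShah.perturb u φ η x • gradient ψ x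
        = (∫ x in Ω, u x • gradient (fun y => (1 + φ y) * ψ y) x)
          - (∫ x in Ω, ψ x • (u x • gradient φ x)) + ∫ x in Ω, η x • gradient ψ x := by
      have isub : Integrable (fun x => u x • gradient (fun y => (1 + φ y) * ψ y) x
          - ψ x • (u x • gradient φ x)) (volume.restrict Ω) := iuχ.sub (bd hψ' iug)
      rw [← integral_sub iuχ (bd hψ' iug), ← integral_add isub iηψ]
      refine integral_congr_ae (ae_of_all _ fun x => ?_)
      simp only [MumfordShah.perturb, gχ]
      module
    have e2 : ∫ x in Ω, ψ x • (g x + incrementGrad u g φ η x)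
        = (∫ x in Ω, ((1 + φ x) * ψ x) • g x) + (∫ x in Ω, ψ x • (u x • gradient φ x))
          + ∫ x in Ω, ψ x • gradient η x := by
      rw [← integral_add (bd hχ' h.integrable_density) (bd hψ' iug),
        ← integral_add ((bd hχ' h.integrable_density).fun_add (bd hψ' iug)) (bd hψ' iη)]
      refine integral_congr_ae (ae_of_all _ fun x => ?_)
      simp only [incrementGrad]
      module
    have e3 : ∫ x, ψ x • σ x ∂(μ.withDensity fun x => ENNReal.ofReal (1 + φ x))
        = ∫ x, ((1 + φ x) * ψ x) • σ x ∂μ := by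
      rw [integral_withDensity_eq_integral_toReal_smul ca.measurable.ennreal_ofReal
        (ae_of_all _ fun x => ENNReal.ofReal_lt_top)]
      refine integral_congr_ae (ae_of_all _ fun x => ?_)
      simp only [ENNReal.toReal_ofReal (hpos x).le, mul_smul]
    rw [e1, e2, e3, h.integral_eq _ hχ, hη.integral_smul_gradient hψ]
    module

/-- The difference splits as a(y)(u(y) - z) plus a term that is continuous in y and vanishes at x;
the first has small average because a is bounded near x. -/
theorem HasApproxLimit.mul_add {a b : Plane → ℝ} {x : Plane} {z : ℝ} (hΩ : IsOpen Ω)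
    (ha : ContinuousAt a x) (hb : ContinuousAt b x) (h : HasApproxLimit Ω u x z) :
    HasApproxLimit Ω (fun y => a y * u y + b y) x (a x * z + b x) := by
  rw [HasApproxLimit, ENNReal.tendsto_nhds_zero] at *
  intro ε hε
  set M : ℝ≥0∞ := ‖a x‖ₑ + 1
  have hM0 : M ≠ 0 := by simp [M]
  have hMt : M ≠ ∞ := by simp [M]
  have hε2 : 0 < ε / 2 := ENNReal.half_pos hε.ne'
  have ev1 : ∀ᶠ y in 𝓝 x, ‖a y‖ₑ < M :=
    ha.enorm.eventually_lt_const (ENNReal.lt_add_right (by simp) one_ne_zero)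
  have ev2 : ∀ᶠ y in 𝓝 x, ‖(a y - a x) * z + (b y - b x)‖ₑ < ε / 2 := by
    have : ContinuousAt (fun y => (a y - a x) * z + (b y - b x)) x := by fun_prop
    refine this.enorm.eventually_lt_const ?_
    simpa using hε2
  obtain ⟨r₀, hr₀, hball⟩ := Metric.eventually_nhds_iff_ball.1 (ev1.and ev2)
  filter_upwards [h (ε / 2 / M) (ENNReal.div_pos hε2.ne' hMt), Ioo_mem_nhdsGT hr₀]
    with r hr hrr
  set s := Metric.ball x r ∩ Ω
  have hs : MeasurableSet s := measurableSet_ball.inter hΩ.measurableSet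
  have hle : ∫⁻ y in s, ‖a y * u y + b y - (a x * z + b x)‖ₑ
      ≤ M * (∫⁻ y in s, ‖u y - z‖ₑ) + ε / 2 * volume s := by
    rw [← lintegral_const_mul' _ _ hMt, ← setLIntegral_const,
      ← lintegral_add_right _ measurable_const]
    refine setLIntegral_mono' hs fun y hy => ?_
    have hy' := hball y (Metric.ball_subset_ball hrr.2.le hy.1)
    have : a y * u y + b y - (a x * z + b x)
        = a y * (u y - z) + ((a y - a x) * z + (b y - b x)) := by ring
    rw [this]
    refine (enorm_add_le _ _).trans (add_le_add ?_ hy'.2.le)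
    rw [enorm_mul]
    exact mul_le_mul_left hy'.1.le _
  rw [setLAverage_eq] at hr ⊢
  calc (∫⁻ y in s, ‖a y * u y + b y - (a x * z + b x)‖ₑ) / volume s
      ≤ (M * (∫⁻ y in s, ‖u y - z‖ₑ) + ε / 2 * volume s) / volume s := by gcongr
    _ = M * ((∫⁻ y in s, ‖u y - z‖ₑ) / volume s) + ε / 2 * (volume s / volume s) := by
        rw [ENNReal.add_div, mul_div_assoc, mul_div_assoc]
    _ ≤ M * (ε / 2 / M) + ε / 2 * 1 := by
        gcongr
        exact ENNReal.div_self_le_one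
    _ = ε := by rw [ENNReal.mul_div_cancel hM0 hMt, mul_one, ENNReal.add_halves]

/-- The inverse of u ↦ au + b has the same form, with coefficients 1/a and -b/a, so one inclusion
gives both. -/
theorem jumpSet_mul_add {a b : Plane → ℝ} (hΩ : IsOpen Ω) (ha : Continuous a) (hb : Continuous b)
    (ha0 : ∀ x, a x ≠ 0) : jumpSet Ω (fun y => a y * u y + b y) = jumpSet Ω u := by
  ext x
  simp only [jumpSet, mem_ofPred_eq, and_congr_right_iff, not_iff_not]
  refine fun _ => ⟨fun ⟨z, hz⟩ => ?_, fun ⟨z, hz⟩ =>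
    ⟨_, hz.mul_add hΩ ha.continuousAt hb.continuousAt⟩⟩
  have := hz.mul_add hΩ (a := fun y => (a y)⁻¹) (b := fun y => -((a y)⁻¹ * b y))
    (ha.inv₀ ha0).continuousAt ((ha.inv₀ ha0).mul hb).neg.continuousAt
  refine ⟨(a x)⁻¹ * z + -((a x)⁻¹ * b x), ?_⟩
  convert this using 1
  funext y
  have := ha0 y
  field_simp
  ring

theorem jumpSet_perturb (hΩ : IsOpen Ω) (hφ : IsTestFunction univ φ)
    (hη : IsTestFunction univ η) (hpos : ∀ x, 0 < 1 + φ x) :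
    jumpSet Ω (perturb u φ η) = jumpSet Ω u :=
  jumpSet_mul_add hΩ (continuous_const.add hφ.continuous) hη.continuous fun x => (hpos x).ne'

theorem IsSBV.perturb (hΩ : IsOpen Ω) (hu : IsSBV Ω u) (hφ : IsTestFunction univ φ)
    (hη : IsTestFunction univ η) (hpos : ∀ x, 0 < 1 + φ x) : IsSBV Ω (perturb u φ η) := by
  obtain ⟨g, σ, μ, h, h0⟩ := hu
  refine ⟨_, _, _, h.perturb hφ hη hpos, ?_⟩
  rw [jumpSet_perturb hΩ hφ hη hpos]
  exact withDensity_absolutelyContinuous _ _ h0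

theorem IsSBV.exists_hasBVDerivative (hu : IsSBV Ω u) :
    ∃ (σ : Plane → Plane) (μ : Measure Plane), HasBVDerivative Ω u (approxGrad Ω u) σ μ := by
  obtain ⟨g, σ, μ, h, -⟩ := hu
  have hex : ∃ (g σ : Plane → Plane) (μ : Measure Plane), HasBVDerivative Ω u g σ μ :=
    ⟨g, σ, μ, h⟩
  rw [approxGrad, dif_pos hex]
  exact hex.choose_spec

theorem approxGrad_perturb_ae (hΩ : IsOpen Ω) (hu : IsSBV Ω u) (hφ : IsTestFunction univ φ)
    (hη : IsTestFunction univ η) (hpos : ∀ x, 0 < 1 + φ x) :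
    approxGrad Ω (perturb u φ η) =ᵐ[volume.restrict Ω]
      fun x => approxGrad Ω u x + incrementGrad u (approxGrad Ω u) φ η x := by
  obtain ⟨σ, μ, h⟩ := hu.exists_hasBVDerivative
  obtain ⟨σ', μ', h'⟩ := (hu.perturb hΩ hφ hη hpos).exists_hasBVDerivative
  exact h'.density_ae_eq hΩ (h.perturb hφ hη hpos) EventuallyEq.rfl

theorem hasApproxLimit_congr {v : Plane → ℝ} {x : Plane} {z : ℝ} (hΩ : IsOpen Ω)
    (h : u =ᶠ[𝓝 x] v) : HasApproxLimit Ω u x z ↔ HasApproxLimit Ω v x z := by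
  refine tendsto_congr' ?_
  obtain ⟨r₀, hr₀, hball⟩ := Metric.eventually_nhds_iff_ball.1 h
  filter_upwards [Ioo_mem_nhdsGT hr₀] with r hr
  rw [setLAverage_eq, setLAverage_eq]
  congr 1
  refine setLIntegral_congr_fun (measurableSet_ball.inter hΩ.measurableSet) fun y hy => ?_
  simp only [hball y (Metric.ball_subset_ball hr.2.le hy.1)]

theorem eqOnBoundary_perturb (hΩ : IsOpen Ω) (hφ : IsTestFunction Ω φ)
    (hη : IsTestFunction Ω η) : EqOnBoundary Ω (perturb u φ η) u := by
  refine ae_restrict_of_forall_mem isClosed_frontier.measurableSet fun x hx => ?_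
  have hxΩ : x ∉ Ω := fun h => hx.2 (hΩ.interior_eq.symm ▸ h)
  have e1 := notMem_tsupport_iff_eventuallyEq.1 fun h => hxΩ (hφ.support_subset h)
  have e2 := notMem_tsupport_iff_eventuallyEq.1 fun h => hxΩ (hη.support_subset h)
  have e : perturb u φ η =ᶠ[𝓝 x] u := by
    filter_upwards [e1, e2] with y h1 h2
    simp [perturb, h1, h2]
  -- The trace is a chosen value; equality of the predicates makes the two choices coincide.
  have : HasApproxLimit Ω (perturb u φ η) x = HasApproxLimit Ω u x :=
    funext fun z => propext (hasApproxLimit_congr hΩ e)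
  unfold bdryTrace
  rw [this]

end Perturbation

/-! ### Inner products in L². -/

section L2Inner

variable {α E : Type*} [MeasurableSpace α] {ν : Measure α} [NormedAddCommGroup E]
  [InnerProductSpace ℝ E] {f g : α → E}

theorem integrable_inner_of_memLp (hf : MemLp f 2 ν) (hg : MemLp g 2 ν) :
    Integrable (fun x => ⟪f x, g x⟫) ν := by
  refine (L2.integrable_inner (𝕜 := ℝ) (hf.toLp f) (hg.toLp g)).congr ?_
  filter_upwards [hf.coeFn_toLp, hg.coeFn_toLp] with x h1 h2
  rw [h1, h2]

theorem inner_toLp_toLp (hf : MemLp f 2 ν) (hg : MemLp g 2 ν) :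
    ⟪hf.toLp f, hg.toLp g⟫ = ∫ x, ⟪f x, g x⟫ ∂ν := by
  rw [L2.inner_def]
  refine integral_congr_ae ?_
  filter_upwards [hf.coeFn_toLp, hg.coeFn_toLp] with x h1 h2
  rw [h1, h2]

theorem abs_integral_inner_le (hf : MemLp f 2 ν) (hg : MemLp g 2 ν) :
    |∫ x, ⟪f x, g x⟫ ∂ν| ≤ (eLpNorm f 2 ν).toReal * (eLpNorm g 2 ν).toReal := by
  rw [← inner_toLp_toLp hf hg, ← Lp.norm_toLp f hf, ← Lp.norm_toLp g hg]
  exact abs_real_inner_le_norm _ _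

end L2Inner

/-! ### First variation of the energy and lower bound for the slope. -/

section SlopeBound

variable {Ω S : Set Plane} {u φ η : Plane → ℝ}

theorem normL2_sq {F : Type*} [NormedAddCommGroup F] {f : Plane → F}
    (hf : MemLp f 2 (volume.restrict Ω)) :
    normL2 Ω f ^ 2 = ENNReal.ofReal (∫ x in Ω, ‖f x‖ ^ 2) := by
  have h := eLpNorm_nnreal_pow_eq_lintegral (μ := volume.restrict Ω) (f := f) (p := 2) two_ne_zero
  simp only [NNReal.coe_ofNat, ENNReal.rpow_ofNat, ENNReal.coe_ofNat] at h
  rw [normL2, h, ofReal_integral_eq_lintegral_ofReal (hf.integrable_norm_pow two_ne_zero)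
    (ae_of_all _ fun x => by positivity)]
  refine lintegral_congr fun x => ?_
  rw [ENNReal.ofReal_pow (norm_nonneg _), ofReal_norm]

theorem IsTestFunction.memLp_smul {F : Type*} [NormedAddCommGroup F] [NormedSpace ℝ F]
    {U : Set Plane} {f : Plane → F} {p : ℝ≥0∞} (hφ : IsTestFunction U φ)
    (hf : MemLp f p (volume.restrict Ω)) :
    MemLp (fun x => φ x • f x) p (volume.restrict Ω) :=
  hf.smul (r := p) (p := ∞) (hφ.memLp Ω ∞)

theorem IsTestFunction.memLp_smul_gradient {U : Set Plane} {p : ℝ≥0∞} (hφ : IsTestFunction U φ)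
    (hu : MemLp u p (volume.restrict Ω)) :
    MemLp (fun x => u x • gradient φ x) p (volume.restrict Ω) :=
  (hφ.memLp_gradient Ω ∞).smul (r := p) hu

theorem memLp_incrementGrad {U V : Set Plane} {g : Plane → Plane} (hφ : IsTestFunction U φ)
    (hη : IsTestFunction V η) (hu : MemLp u 2 (volume.restrict Ω))
    (hg : MemLp g 2 (volume.restrict Ω)) :
    MemLp (incrementGrad u g φ η) 2 (volume.restrict Ω) :=
  ((hφ.memLp_smul hg).add (hφ.memLp_smul_gradient hu)).add (hη.memLp_gradient Ω 2)

theorem integral_norm_add_smul_sq {G w : Plane → Plane} (hG : MemLp G 2 (volume.restrict Ω))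
    (hw : MemLp w 2 (volume.restrict Ω)) (ε : ℝ) :
    ∫ x in Ω, ‖G x + ε • w x‖ ^ 2
      = (∫ x in Ω, ‖G x‖ ^ 2) + 2 * ε * (∫ x in Ω, ⟪G x, w x⟫) + ε ^ 2 * ∫ x in Ω, ‖w x‖ ^ 2 := by
  have i1 := hG.integrable_norm_pow two_ne_zero
  have i2 := hw.integrable_norm_pow two_ne_zero
  have i3 : Integrable (fun x => ⟪G x, w x⟫) (volume.restrict Ω) := integrable_inner_of_memLp hG hw
  have i4 : Integrable (fun x => ‖G x‖ ^ 2 + 2 * ε * ⟪G x, w x⟫) (volume.restrict Ω) :=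
    i1.add (i3.const_mul _)
  rw [← integral_const_mul, ← integral_const_mul, ← integral_add i1 (i3.const_mul _),
    ← integral_add i4 (i2.const_mul _)]
  refine integral_congr_ae (ae_of_all _ fun x => ?_)
  simp only [norm_add_sq_real, inner_smul_right, norm_smul, mul_pow, Real.norm_eq_abs, sq_abs]
  ring

theorem IsTestFunction.eventually_pos (hφ : IsTestFunction univ φ) :
    ∀ᶠ ε : ℝ in 𝓝[>] 0, ∀ x, 0 < 1 + ε * φ x := by
  obtain ⟨C, hC0, hC⟩ := hφ.exists_bound
  filter_upwards [Ioo_mem_nhdsGT (show (0 : ℝ) < 1 / (C + 1) by positivity)] with ε hε x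
  have h1 : ε * (C + 1) < 1 := (lt_div_iff₀ (by positivity)).1 hε.2
  nlinarith [hε.1, (abs_le.1 (hC x)).1]

theorem perturb_const_mul (ε : ℝ) (x : Plane) :
    perturb u (fun x => ε * φ x) (fun x => ε * η x) x = u x + ε * (φ x * u x + η x) := by
  simp only [perturb]
  ring

theorem normL2_perturb_sub {ε : ℝ} (hε : 0 < ε) :
    normL2 Ω (perturb u (fun x => ε * φ x) (fun x => ε * η x) - u)
      = ENNReal.ofReal ε * normL2 Ω (fun x => φ x * u x + η x) := by
  have : perturb u (fun x => ε * φ x) (fun x => ε * η x) - u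
      = ε • fun x => φ x * u x + η x := by
    funext x
    simp [perturb_const_mul]
  rw [normL2, this, eLpNorm_const_smul, Real.enorm_eq_ofReal hε.le]
  rfl

theorem incrementGrad_const_mul {U V : Set Plane} {g : Plane → Plane} (hφ : IsTestFunction U φ)
    (hη : IsTestFunction V η) (ε : ℝ) (x : Plane) :
    incrementGrad u g (fun x => ε * φ x) (fun x => ε * η x) x = ε • incrementGrad u g φ η x := by
  simp only [incrementGrad, gradient_const_mul_apply ε (hφ.differentiable x),
    gradient_const_mul_apply ε (hη.differentiable x)]
  module

theorem approxGrad_perturb_const_mul_ae (hΩ : IsOpen Ω) (hu : IsSBV Ω u)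
    (hφ : IsTestFunction univ φ) (hη : IsTestFunction univ η) {ε : ℝ}
    (hε : ∀ x, 0 < 1 + ε * φ x) :
    approxGrad Ω (perturb u (fun x => ε * φ x) (fun x => ε * η x)) =ᵐ[volume.restrict Ω]
      fun x => approxGrad Ω u x + ε • incrementGrad u (approxGrad Ω u) φ η x := by
  filter_upwards [approxGrad_perturb_ae hΩ hu (hφ.const_mul ε) (hη.const_mul ε) hε] with x hx
  rw [hx, incrementGrad_const_mul hφ hη]

/-- The perturbed function equals u a.e., so uniqueness of the density forces a zero increment. This
settles the directions of zero norm, along which v ≠ u fails. -/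
theorem incrementGrad_ae_eq_zero (hΩ : IsOpen Ω) (hu : IsSBV Ω u)
    (hφ : IsTestFunction univ φ) (hη : IsTestFunction univ η)
    (h0 : (fun x => φ x * u x + η x) =ᵐ[volume.restrict Ω] 0) :
    incrementGrad u (approxGrad Ω u) φ η =ᵐ[volume.restrict Ω] 0 := by
  obtain ⟨ε, hpos, hε⟩ := (hφ.eventually_pos.and self_mem_nhdsWithin).exists
  obtain ⟨σ, μ, h⟩ := hu.exists_hasBVDerivative
  have h' := h.perturb (hφ.const_mul ε) (hη.const_mul ε) hpos
  have hv : perturb u (fun x => ε * φ x) (fun x => ε * η x) =ᵐ[volume.restrict Ω] u := by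
    filter_upwards [h0] with x hx
    rw [perturb_const_mul, hx]
    simp
  filter_upwards [h'.density_ae_eq hΩ h hv] with x hx
  rw [incrementGrad_const_mul hφ hη, add_eq_left] at hx
  exact (smul_eq_zero.1 hx).resolve_left (ne_of_gt hε)

/-- The lengths cancel because the jump set of the perturbation is that of u, contained in S up to a
null set. What remains is the expansion of ‖∇u + εw‖², divided by ε. -/
theorem slopeQuotient_perturb_ge (hΩ : IsOpen Ω)
    (hS : (Measure.hausdorffMeasure 1 : Measure Plane) S < ∞) (hu : IsSBV2 Ω S u)
    (hφ : IsTestFunction univ φ) (hη : IsTestFunction univ η) {ε : ℝ} (hε0 : 0 < ε)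
    (hε : ∀ x, 0 < 1 + ε * φ x) :
    ENNReal.ofReal (-2 * (∫ x in Ω, ⟪approxGrad Ω u x, incrementGrad u (approxGrad Ω u) φ η x⟫)
        - ε * ∫ x in Ω, ‖incrementGrad u (approxGrad Ω u) φ η x‖ ^ 2)
        / normL2 Ω (fun x => φ x * u x + η x)
      ≤ slopeQuotient Ω u S (perturb u (fun x => ε * φ x) (fun x => ε * η x)) := by
  set v := perturb u (fun x => ε * φ x) (fun x => ε * η x)
  set G := approxGrad Ω u
  set w := incrementGrad u G φ η
  have hw : MemLp w 2 (volume.restrict Ω) := memLp_incrementGrad hφ hη hu.memLp hu.memLp_grad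
  have hJ : jumpSet Ω v = jumpSet Ω u := jumpSet_perturb hΩ (hφ.const_mul ε) (hη.const_mul ε) hε
  have hmeas : (Measure.hausdorffMeasure 1 : Measure Plane) (S ∪ jumpSet Ω v)
      ≤ (Measure.hausdorffMeasure 1 : Measure Plane) S := by
    rw [hJ, ← union_sdiff_self]
    refine (measure_union_le _ _).trans ?_
    rw [hu.jumpSet_subset, add_zero]
  have hgrad := approxGrad_perturb_const_mul_ae hΩ hu.sbv hφ hη hε
  have e1 : normL2 Ω (approxGrad Ω v) ^ 2 = ENNReal.ofReal (∫ x in Ω, ‖G x + ε • w x‖ ^ 2) := by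
    rw [normL2, eLpNorm_congr_ae hgrad]
    exact normL2_sq (hu.memLp_grad.add (hw.const_smul ε))
  have e2 : normL2 Ω (v - u) = ENNReal.ofReal ε * normL2 Ω (fun x => φ x * u x + η x) :=
    normL2_perturb_sub hε0
  have hε0' : ENNReal.ofReal ε ≠ 0 := by simpa using hε0
  rw [slopeQuotient, e2, ← ENNReal.mul_div_mul_left _ _ hε0' ENNReal.ofReal_ne_top]
  gcongr
  rw [energy, energy, e1, normL2_sq hu.memLp_grad]
  refine le_trans ?_ (tsub_le_tsub_left (add_le_add_right hmeas _) _)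
  rw [ENNReal.add_sub_add_eq_sub_right hS.ne, ← ENNReal.ofReal_mul hε0.le]
  rw [← ENNReal.ofReal_sub _ (integral_nonneg fun x => by positivity),
    integral_norm_add_smul_sq hu.memLp_grad hw]
  exact ENNReal.ofReal_le_ofReal (le_of_eq (by ring))

/-- The set `A` of competitors is left free so that both slopes, with and without boundary
condition, are covered. -/
theorem ofReal_le_limsup_slopeQuotient_mul (hΩ : IsOpen Ω)
    (hS : (Measure.hausdorffMeasure 1 : Measure Plane) S < ∞) (hu : IsSBV2 Ω S u)
    (hφ : IsTestFunction univ φ) (hη : IsTestFunction univ η) {A : Set (Plane → ℝ)}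
    (hA : ∀ ε : ℝ, (∀ x, 0 < 1 + ε * φ x) → perturb u (fun x => ε * φ x) (fun x => ε * η x) ∈ A) :
    ENNReal.ofReal (-2 * ∫ x in Ω, ⟪approxGrad Ω u x, incrementGrad u (approxGrad Ω u) φ η x⟫)
      ≤ limsup (slopeQuotient Ω u S) (puncturedL2 Ω u ⊓ 𝓟 A)
        * normL2 Ω (fun x => φ x * u x + η x) := by
  set ψ : Plane → ℝ := fun x => φ x * u x + η x
  have hψ : MemLp ψ 2 (volume.restrict Ω) := (hφ.memLp_smul hu.memLp).add (hη.memLp Ω 2)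
  by_cases h0 : normL2 Ω ψ = 0
  · have hz := incrementGrad_ae_eq_zero hΩ hu.sbv hφ hη
      ((eLpNorm_eq_zero_iff hψ.1 two_ne_zero).1 h0)
    have : ∫ x in Ω, ⟪approxGrad Ω u x, incrementGrad u (approxGrad Ω u) φ η x⟫ = 0 := by
      refine integral_eq_zero_of_ae ?_
      filter_upwards [hz] with x hx
      rw [hx]
      simp
    simp [this]
  have hT : normL2 Ω ψ ≠ ∞ := hψ.2.ne
  rw [← ENNReal.div_le_iff h0 hT]
  set I := ∫ x in Ω, ⟪approxGrad Ω u x, incrementGrad u (approxGrad Ω u) φ η x⟫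
  set B := ∫ x in Ω, ‖incrementGrad u (approxGrad Ω u) φ η x‖ ^ 2
  set v : ℝ → Plane → ℝ := fun ε => perturb u (fun x => ε * φ x) (fun x => ε * η x)
  have e2 : ∀ ε : ℝ, 0 < ε → normL2 Ω (v ε - u) = ENNReal.ofReal ε * normL2 Ω ψ :=
    fun ε hε0 => normL2_perturb_sub hε0
  have hlim : Tendsto v (𝓝[>] 0) (puncturedL2 Ω u ⊓ 𝓟 A) := by
    refine tendsto_inf.2 ⟨tendsto_comap_iff.2 (tendsto_nhdsWithin_iff.2 ⟨?_, ?_⟩), ?_⟩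
    · have : Tendsto (fun ε : ℝ => ENNReal.ofReal ε * normL2 Ω ψ) (𝓝[>] 0) (𝓝 0) := by
        have h1 : Tendsto (fun ε : ℝ => ENNReal.ofReal ε) (𝓝[>] 0) (𝓝 0) := by
          have := (ENNReal.continuous_ofReal.tendsto (0 : ℝ)).mono_left
            (nhdsWithin_le_nhds (s := Ioi 0))
          rwa [ENNReal.ofReal_zero] at this
        have := ENNReal.Tendsto.mul_const h1 (Or.inr hT)
        rwa [zero_mul] at this
      refine this.congr' ?_
      filter_upwards [self_mem_nhdsWithin] with ε hε using (e2 ε hε).symm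
    · filter_upwards [self_mem_nhdsWithin] with ε hε
      simp only [Function.comp, mem_Ioi, e2 ε hε]
      exact ENNReal.mul_pos (by simpa using hε) h0
    · refine tendsto_principal.2 ?_
      filter_upwards [hφ.eventually_pos] with ε hε using hA ε hε
  have hc : Tendsto (fun ε : ℝ => ENNReal.ofReal (-2 * I - ε * B) / normL2 Ω ψ) (𝓝[>] 0)
      (𝓝 (ENNReal.ofReal (-2 * I) / normL2 Ω ψ)) := by
    refine ENNReal.Tendsto.div_const ?_ (Or.inr h0)
    have : Continuous fun ε : ℝ => ENNReal.ofReal (-2 * I - ε * B) :=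
      ENNReal.continuous_ofReal.comp (by fun_prop)
    have := (this.tendsto 0).mono_left (nhdsWithin_le_nhds (s := Ioi 0))
    simpa using this
  rw [← hc.limsup_eq]
  calc limsup (fun ε : ℝ => ENNReal.ofReal (-2 * I - ε * B) / normL2 Ω ψ) (𝓝[>] 0)
      ≤ limsup (slopeQuotient Ω u S ∘ v) (𝓝[>] 0) := by
        refine limsup_le_limsup ?_
        filter_upwards [hφ.eventually_pos, self_mem_nhdsWithin] with ε hε hε0
        exact slopeQuotient_perturb_ge hΩ hS hu hφ hη hε0 hε
    _ ≤ _ := by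
        rw [limsup_comp]
        exact limsup_le_limsup_of_le hlim

theorem neg_two_mul_integral_le_of_limsup_le (hΩ : IsOpen Ω)
    (hS : (Measure.hausdorffMeasure 1 : Measure Plane) S < ∞) (hu : IsSBV2 Ω S u)
    (hφ : IsTestFunction univ φ) (hη : IsTestFunction univ η) {A : Set (Plane → ℝ)}
    (hA : ∀ ε : ℝ, (∀ x, 0 < 1 + ε * φ x) → perturb u (fun x => ε * φ x) (fun x => ε * η x) ∈ A)
    {M : ℝ≥0}
    (hM : limsup (slopeQuotient Ω u S) (puncturedL2 Ω u ⊓ 𝓟 A) ≤ M) :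
    -2 * (∫ x in Ω, ⟪approxGrad Ω u x, incrementGrad u (approxGrad Ω u) φ η x⟫)
      ≤ M * (normL2 Ω (fun x => φ x * u x + η x)).toReal := by
  have hψ : MemLp (fun x => φ x * u x + η x) 2 (volume.restrict Ω) :=
    (hφ.memLp_smul hu.memLp).add (hη.memLp Ω 2)
  have hT : normL2 Ω (fun x => φ x * u x + η x) ≠ ∞ := hψ.2.ne
  have h := (ofReal_le_limsup_slopeQuotient_mul hΩ hS hu hφ hη hA).trans
    (mul_le_mul_left hM _)
  have h2 := (ENNReal.ofReal_le_iff_le_toReal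
    (ENNReal.mul_ne_top ENNReal.coe_ne_top hT)).1 h
  simpa using h2

end SlopeBound

/-! ### Riesz representation and density of test functions in L². -/

section Riesz

/-- A linear functional dominated by the norm of a linear map into a Hilbert space is represented
by a vector of that space. -/
theorem exists_eq_inner_of_le_norm {V H : Type*} [AddCommGroup V] [Module ℝ V]
    [NormedAddCommGroup H] [InnerProductSpace ℝ H] [CompleteSpace H] (ι : V →ₗ[ℝ] H)
    (l : V →ₗ[ℝ] ℝ) {C : ℝ} (hC : 0 ≤ C) (hl : ∀ v, |l v| ≤ C * ‖ι v‖) :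
    ∃ h : H, ‖h‖ ≤ C ∧ ∀ v, l v = ⟪h, ι v⟫ := by
  have hker : LinearMap.ker ι ≤ LinearMap.ker l := fun v hv => by
    have := hl v
    rw [LinearMap.mem_ker.1 hv, norm_zero, mul_zero] at this
    exact abs_nonpos_iff.1 this
  let l' : LinearMap.range ι →ₗ[ℝ] ℝ :=
    ((LinearMap.ker ι).liftQ l hker) ∘ₗ ι.quotKerEquivRange.symm.toLinearMap
  have hl' : ∀ v, l' ⟨ι v, LinearMap.mem_range_self ι v⟩ = l v := fun v => by
    simp only [l', LinearMap.comp_apply, LinearEquiv.coe_coe]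
    rw [LinearMap.quotKerEquivRange_symm_apply_image ι v (LinearMap.mem_range_self ι v)]
    simp
  let L : StrongDual ℝ (LinearMap.range ι) := l'.mkContinuous C (by
    rintro ⟨_, v, rfl⟩
    rw [hl' v]
    exact hl v)
  -- The range of `ι` need not be closed, so the functional is extended by Hahn–Banach before the
  -- Riesz representation on `H`.
  obtain ⟨g, hg, hgn⟩ := exists_extension_norm_eq (LinearMap.range ι) L
  refine ⟨(InnerProductSpace.toDual ℝ H).symm g, ?_, fun v => ?_⟩
  · rw [LinearIsometryEquiv.norm_map, hgn]
    exact LinearMap.mkContinuous_norm_le _ hC _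
  · rw [InnerProductSpace.toDual_symm_apply, ← hl' v]
    exact (hg ⟨ι v, LinearMap.mem_range_self ι v⟩).symm

/-- The space `C_c^∞(U)`. -/
def testFunctions (U : Set Plane) : Submodule ℝ (Plane → ℝ) where
  carrier := {φ | IsTestFunction U φ}
  add_mem' h h' := h.add h'
  zero_mem' := IsTestFunction.zero
  smul_mem' c _ h := h.const_mul c

variable {U Ω : Set Plane}

/-- The restriction map `C_c^∞(U) → L²(Ω)`. -/
noncomputable def testToL2 (U Ω : Set Plane) :
    testFunctions U →ₗ[ℝ] Lp ℝ 2 (volume.restrict Ω) where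
  toFun φ := MemLp.toLp φ.1 (IsTestFunction.memLp φ.2 Ω 2)
  map_add' _ _ := rfl
  map_smul' _ _ := rfl

/-- The functional `φ ↦ ∫_Ω G · ∇φ` on `C_c^∞(U)`. -/
noncomputable def integralInnerGradient (U : Set Plane) {G : Plane → Plane}
    (hG : MemLp G 2 (volume.restrict Ω)) : testFunctions U →ₗ[ℝ] ℝ where
  toFun φ := ∫ x in Ω, ⟪G x, gradient φ.1 x⟫
  map_add' φ ψ := by
    have hφ : IsTestFunction U φ.1 := φ.2
    have hψ : IsTestFunction U ψ.1 := ψ.2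
    rw [← integral_add (integrable_inner_of_memLp hG (hφ.memLp_gradient Ω 2))
      (integrable_inner_of_memLp hG (hψ.memLp_gradient Ω 2))]
    refine integral_congr_ae (ae_of_all _ fun x => ?_)
    have := gradient_add_apply (hφ.differentiable x) (hψ.differentiable x)
    simp only [← inner_add_right, ← this]
    rfl
  map_smul' c φ := by
    have hφ : IsTestFunction U φ.1 := φ.2
    rw [RingHom.id_apply, smul_eq_mul, ← integral_const_mul]
    refine integral_congr_ae (ae_of_all _ fun x => ?_)
    have := gradient_const_mul_apply c (hφ.differentiable x)
    simp only [← inner_smul_right, ← this]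
    rfl

theorem integral_inner_real {f g : Plane → ℝ} :
    ∫ x in Ω, ⟪f x, g x⟫ = ∫ x in Ω, f x * g x := by
  simp only [Real.inner_apply]

/-- The support set `U` is kept apart from the integration domain `Ω`: `U = Ω` serves the equation
in Ω, `U = univ` the one in the plane. -/
theorem exists_negDiv_of_bound {G : Plane → Plane} (hG : MemLp G 2 (volume.restrict Ω)) {C : ℝ}
    (hC : 0 ≤ C)
    (h : ∀ φ, IsTestFunction U φ →
      |∫ x in Ω, ⟪G x, gradient φ x⟫| ≤ C * (normL2 Ω φ).toReal) :
    ∃ f : Plane → ℝ, MemLp f 2 (volume.restrict Ω) ∧ normL2 Ω f ≤ ENNReal.ofReal C ∧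
      ∀ φ, IsTestFunction U φ → ∫ x in Ω, ⟪G x, gradient φ x⟫ = ∫ x in Ω, f x * φ x := by
  obtain ⟨f, hf, hfe⟩ := exists_eq_inner_of_le_norm (testToL2 U Ω) (integralInnerGradient U hG) hC
    (fun φ => by
      have e : ‖testToL2 U Ω φ‖ = (normL2 Ω φ.1).toReal :=
        Lp.norm_toLp _ (IsTestFunction.memLp φ.2 Ω 2)
      rw [e]
      exact h φ.1 φ.2)
  refine ⟨f, Lp.memLp f, ?_, fun φ hφ => ?_⟩
  · rw [Lp.norm_def] at hf
    exact (ENNReal.le_ofReal_iff_toReal_le (Lp.eLpNorm_ne_top f) hC).2 hf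
  · have e1 : ∫ x in Ω, ⟪G x, gradient φ x⟫ = ⟪f, testToL2 U Ω ⟨φ, hφ⟩⟫ := hfe ⟨φ, hφ⟩
    have e2 := inner_toLp_toLp (Lp.memLp f) (hφ.memLp Ω 2)
    rw [Lp.toLp_coeFn, integral_inner_real] at e2
    exact e1.trans e2

theorem ae_eq_zero_of_integral_mul_test (hΩ : IsOpen Ω) {f : Plane → ℝ}
    (hf : MemLp f 2 (volume.restrict Ω))
    (h : ∀ φ, IsTestFunction Ω φ → ∫ x in Ω, f x * φ x = 0) : f =ᵐ[volume.restrict Ω] 0 := by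
  have key := hΩ.ae_eq_zero_of_integral_contDiff_smul_eq_zero (μ := volume.restrict Ω)
    ((hf.locallyIntegrable one_le_two).locallyIntegrableOn Ω) (fun φ h1 h2 h3 => by
      simpa only [smul_eq_mul, mul_comm] using h φ ⟨h1, h2, h3⟩)
  filter_upwards [key, ae_restrict_mem hΩ.measurableSet] with x h1 h2 using h1 h2

/-- By the fundamental lemma nothing but zero is orthogonal to all test functions, so their span is
dense. -/
theorem exists_test_normL2_sub_lt (hΩ : IsOpen Ω) {ψ : Plane → ℝ}
    (hψ : MemLp ψ 2 (volume.restrict Ω)) {δ : ℝ} (hδ : 0 < δ) :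
    ∃ η, IsTestFunction Ω η ∧ (normL2 Ω (fun x => ψ x - η x)).toReal < δ := by
  have hbot : (LinearMap.range (testToL2 Ω Ω))ᗮ = ⊥ := by
    refine (Submodule.eq_bot_iff _).2 fun f hf => ?_
    refine Lp.ext ((ae_eq_zero_of_integral_mul_test hΩ (Lp.memLp f) fun φ hφ => ?_).trans
      (Lp.coeFn_zero ℝ 2 (volume.restrict Ω)).symm)
    have h1 : ⟪testToL2 Ω Ω ⟨φ, hφ⟩, f⟫ = 0 :=
      (Submodule.mem_orthogonal _ _).1 hf _ (LinearMap.mem_range_self _ _)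
    have e2 := inner_toLp_toLp (Lp.memLp f) (hφ.memLp Ω 2)
    rw [Lp.toLp_coeFn, integral_inner_real] at e2
    rw [← e2, real_inner_comm]
    exact h1
  have hmem : hψ.toLp ψ ∈ closure (LinearMap.range (testToL2 Ω Ω) : Set (Lp ℝ 2 _)) := by
    have := Submodule.topologicalClosure_eq_top_iff.2 hbot
    rw [← Submodule.topologicalClosure_coe, this]
    trivial
  obtain ⟨_, ⟨⟨η, hη⟩, rfl⟩, hd⟩ := Metric.mem_closure_iff.1 hmem δ hδ
  refine ⟨η, hη, ?_⟩
  have hη' : MemLp η 2 (volume.restrict Ω) := IsTestFunction.memLp hη Ω 2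
  have e : dist (hψ.toLp ψ) (testToL2 Ω Ω ⟨η, hη⟩) = (normL2 Ω (fun x => ψ x - η x)).toReal := by
    rw [dist_eq_norm]
    change ‖hψ.toLp ψ - hη'.toLp η‖ = _
    rw [← MemLp.toLp_sub, Lp.norm_toLp]
    rfl
  rwa [e] at hd

end Riesz

/-! ### Products of weakly and strongly convergent sequences. -/

section WeakConvergence

variable {Ω : Set Plane} {G : ℕ → Plane → Plane} {G' : Plane → Plane}

/-- Uniform boundedness principle: each pairing converges, hence is bounded. -/
theorem WeakConvL2.exists_bound (h : WeakConvL2 Ω G G') :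
    ∃ C : ℝ, ∀ k, (normL2 Ω (G k)).toReal ≤ C := by
  obtain ⟨C, hC⟩ := banach_steinhaus (g := fun k => innerSL ℝ ((h.memLp k).toLp (G k)))
    (fun f => by
      have e : ∀ k, innerSL ℝ ((h.memLp k).toLp (G k)) f = ∫ x in Ω, ⟪G k x, f x⟫ := fun k => by
        have := inner_toLp_toLp (h.memLp k) (Lp.memLp f)
        rw [Lp.toLp_coeFn] at this
        exact this
      obtain ⟨C, hC⟩ := (h.tendsto f (Lp.memLp f)).norm.bddAbove_range
      refine ⟨C, fun k => ?_⟩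
      rw [e]
      exact hC (mem_range_self k))
  refine ⟨C, fun k => ?_⟩
  have := hC k
  rw [innerSL_apply_norm, Lp.norm_toLp] at this
  exact this

theorem WeakConvL2.tendsto_integral_inner (h : WeakConvL2 Ω G G') {H : ℕ → Plane → Plane}
    {H' : Plane → Plane} (hH : ∀ k, MemLp (H k) 2 (volume.restrict Ω))
    (hH' : MemLp H' 2 (volume.restrict Ω))
    (hlim : Tendsto (fun k => (normL2 Ω (fun x => H k x - H' x)).toReal) atTop (𝓝 0)) :
    Tendsto (fun k => ∫ x in Ω, ⟪G k x, H k x⟫) atTop (𝓝 (∫ x in Ω, ⟪G' x, H' x⟫)) := by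
  obtain ⟨C, hC⟩ := h.exists_bound
  have hd : ∀ k, MemLp (fun x => H k x - H' x) 2 (volume.restrict Ω) := fun k => (hH k).sub hH'
  have h0 : Tendsto (fun k => ∫ x in Ω, ⟪G k x, H k x - H' x⟫) atTop (𝓝 0) := by
    refine squeeze_zero_norm (fun k => ?_) (by simpa using hlim.const_mul C)
    refine (abs_integral_inner_le (h.memLp k) (hd k)).trans ?_
    exact mul_le_mul_of_nonneg_right (hC k) ENNReal.toReal_nonneg
  have := h0.add (h.tendsto H' hH')
  rw [zero_add] at this
  refine this.congr fun k => ?_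
  rw [← integral_add (integrable_inner_of_memLp (h.memLp k) (hd k))
    (integrable_inner_of_memLp (h.memLp k) hH')]
  refine integral_congr_ae (ae_of_all _ fun x => ?_)
  simp only [← inner_add_right, sub_add_cancel]

theorem normL2_toReal_le_mul {E F : Type*} [NormedAddCommGroup E] [NormedAddCommGroup F]
    {f : Plane → E} {g : Plane → F} {D : ℝ} (hD : 0 ≤ D) (hg : MemLp g 2 (volume.restrict Ω))
    (h : ∀ x, ‖f x‖ ≤ D * ‖g x‖) :
    (normL2 Ω f).toReal ≤ D * (normL2 Ω g).toReal := by
  have h1 : normL2 Ω f ≤ ENNReal.ofReal D * normL2 Ω g :=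
    eLpNorm_le_mul_eLpNorm_of_ae_le_mul (ae_of_all _ h) 2
  have hT : normL2 Ω g ≠ ∞ := hg.2.ne
  have h2 := ENNReal.toReal_mono (ENNReal.mul_ne_top ENNReal.ofReal_ne_top hT) h1
  rwa [ENNReal.toReal_mul, ENNReal.toReal_ofReal hD] at h2

theorem tendsto_normL2_toReal {E : Type*} [NormedAddCommGroup E] {H : ℕ → Plane → E}
    {H' : Plane → E} (hH : ∀ k, MemLp (H k) 2 (volume.restrict Ω))
    (hH' : MemLp H' 2 (volume.restrict Ω))
    (hlim : Tendsto (fun k => (normL2 Ω (fun x => H k x - H' x)).toReal) atTop (𝓝 0)) :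
    Tendsto (fun k => (normL2 Ω (H k)).toReal) atTop (𝓝 (normL2 Ω H').toReal) := by
  refine tendsto_iff_dist_tendsto_zero.2 (squeeze_zero (fun _ => dist_nonneg) (fun k => ?_) hlim)
  have e := abs_norm_sub_norm_le ((hH k).toLp (H k)) (hH'.toLp H')
  rw [← MemLp.toLp_sub, Lp.norm_toLp, Lp.norm_toLp, Lp.norm_toLp] at e
  exact e

end WeakConvergence

/-! ### Passage to the limit along admissible sequences. -/

section RelaxedSlope

variable {Ω S : Set Plane} {u : Plane → ℝ} {uk : ℕ → Plane → ℝ} {Sk : ℕ → Set Plane}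

theorem AdmissibleSequence.hausdorffMeasure_lt_top (h : AdmissibleSequence Ω u S uk Sk) (k : ℕ) :
    (Measure.hausdorffMeasure 1 : Measure Plane) (Sk k) < ∞ := by
  obtain ⟨C, hC⟩ := h.sigma2.bounded
  exact (hC k).trans_lt ENNReal.coe_lt_top

theorem AdmissibleSequence.memLp_sub (h : AdmissibleSequence Ω u S uk Sk)
    (hu : MemLp u 2 (volume.restrict Ω)) (k : ℕ) :
    MemLp (fun x => uk k x - u x) 2 (volume.restrict Ω) :=
  (h.sbv2 k).memLp.sub hu

theorem AdmissibleSequence.tendsto_toReal (h : AdmissibleSequence Ω u S uk Sk) :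
    Tendsto (fun k => (normL2 Ω (fun x => uk k x - u x)).toReal) atTop (𝓝 0) := by
  have := (ENNReal.tendsto_toReal ENNReal.zero_ne_top).comp h.strong
  rwa [ENNReal.toReal_zero] at this

/-- First variation with φ = 0, linear in ∇u_k. The slope lies below M only for infinitely many k,
which is enough to bound the limit. -/
theorem AdmissibleSequence.neg_two_mul_integral_le (hΩ : IsOpen Ω)
    (h : AdmissibleSequence Ω u S uk Sk) {A : (Plane → ℝ) → Set (Plane → ℝ)} {U : Set Plane}
    {η : Plane → ℝ} (hη : IsTestFunction U η)
    (hA : ∀ k (ε : ℝ), perturb (uk k) (fun _ => ε * 0) (fun x => ε * η x) ∈ A (uk k)) {M : ℝ≥0}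
    (hM : liminf (fun k => limsup (slopeQuotient Ω (uk k) (Sk k))
      (puncturedL2 Ω (uk k) ⊓ 𝓟 (A (uk k)))) atTop < M) :
    -2 * (∫ x in Ω, ⟪approxGrad Ω u x, gradient η x⟫) ≤ M * (normL2 Ω η).toReal := by
  have hfreq := frequently_lt_of_liminf_lt (by isBoundedDefault) hM
  have hlim := (h.weak_grad.tendsto _ (hη.memLp_gradient Ω 2)).const_mul (-2)
  refine le_of_tendsto_of_frequently hlim (hfreq.mono fun k hk => ?_)
  have := neg_two_mul_integral_le_of_limsup_le hΩ (h.hausdorffMeasure_lt_top k) (h.sbv2 k)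
    (IsTestFunction.zero (U := univ)) (hη.mono (subset_univ U)) (fun ε _ => hA k ε) hk.le
  have e : ∀ g : Plane → Plane, incrementGrad (uk k) g (fun _ => 0) η = gradient η := fun g => by
    funext x
    simp [incrementGrad, gradient_fun_const]
  simpa [e] using this

/-- Let M decrease to r, then use both η and -η. -/
theorem IsTestFunction.abs_integral_inner_gradient_le {U : Set Plane} {G : Plane → Plane}
    {r : ℝ≥0∞} (hr : r < ∞)
    (h : ∀ M : ℝ≥0, r < M → ∀ η, IsTestFunction U η →
      -2 * (∫ x in Ω, ⟪G x, gradient η x⟫) ≤ M * (normL2 Ω η).toReal)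
    {η : Plane → ℝ} (hη : IsTestFunction U η) :
    |∫ x in Ω, ⟪G x, gradient η x⟫| ≤ r.toReal / 2 * (normL2 Ω η).toReal := by
  have key : ∀ η, IsTestFunction U η →
      -2 * (∫ x in Ω, ⟪G x, gradient η x⟫) ≤ r.toReal * (normL2 Ω η).toReal := by
    intro η hη
    have ht : Tendsto (fun s : ℝ => s * (normL2 Ω η).toReal) (𝓝[>] r.toReal)
        (𝓝 (r.toReal * (normL2 Ω η).toReal)) :=
      ((continuous_id.mul continuous_const).tendsto _).mono_left nhdsWithin_le_nhds
    refine ge_of_tendsto ht ?_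
    filter_upwards [self_mem_nhdsWithin] with s hs
    have hs0 : 0 ≤ s := ENNReal.toReal_nonneg.trans (le_of_lt hs)
    lift s to ℝ≥0 using hs0
    exact h s ((ENNReal.toReal_lt_toReal hr.ne ENNReal.coe_ne_top).1 hs) η hη
  have h1 := key η hη
  have h2 := key _ (hη.const_mul (-1))
  have e1 : ∫ x in Ω, ⟪G x, gradient (fun y => -1 * η y) x⟫
      = -∫ x in Ω, ⟪G x, gradient η x⟫ := by
    rw [← integral_neg]
    refine integral_congr_ae (ae_of_all _ fun x => ?_)
    simp only [gradient_const_mul_apply (-1) (hη.differentiable x), inner_smul_right]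
    ring
  have e2 : normL2 Ω (fun x => -1 * η x) = normL2 Ω η := by
    have : (fun x => -1 * η x) = -η := by
      funext x
      simp
    rw [this, normL2, eLpNorm_neg]
    rfl
  rw [e1, e2] at h2
  rw [abs_le]
  constructor <;> linarith

theorem abs_integral_inner_gradient_le_relaxedSlopeB (hΩ : IsOpen Ω)
    (hr : relaxedSlopeB Ω u S < ∞) {η : Plane → ℝ} (hη : IsTestFunction Ω η) :
    |∫ x in Ω, ⟪approxGrad Ω u x, gradient η x⟫|
      ≤ (relaxedSlopeB Ω u S).toReal / 2 * (normL2 Ω η).toReal := by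
  refine IsTestFunction.abs_integral_inner_gradient_le hr (fun M hM η hη => ?_) hη
  obtain ⟨uk, hM⟩ := iInf_lt_iff.1 hM
  obtain ⟨Sk, hM⟩ := iInf_lt_iff.1 hM
  obtain ⟨h, hM⟩ := iInf_lt_iff.1 hM
  refine h.neg_two_mul_integral_le hΩ (A := fun u => {v | IsSBV Ω v ∧ EqOnBoundary Ω v u}) hη
    (fun k ε => ?_) hM
  have h0 : ∀ U, IsTestFunction U fun _ => ε * 0 := fun U => IsTestFunction.zero.const_mul ε
  exact ⟨(h.sbv2 k).sbv.perturb hΩ (h0 _) ((hη.const_mul ε).mono (subset_univ Ω)) (by simp),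
    eqOnBoundary_perturb hΩ (h0 _) (hη.const_mul ε)⟩

theorem abs_integral_inner_gradient_le_relaxedSlope (hΩ : IsOpen Ω)
    (hr : relaxedSlope Ω u S < ∞) {η : Plane → ℝ} (hη : IsTestFunction univ η) :
    |∫ x in Ω, ⟪approxGrad Ω u x, gradient η x⟫|
      ≤ (relaxedSlope Ω u S).toReal / 2 * (normL2 Ω η).toReal := by
  refine IsTestFunction.abs_integral_inner_gradient_le hr (fun M hM η hη => ?_) hη
  obtain ⟨uk, hM⟩ := iInf_lt_iff.1 hM
  obtain ⟨Sk, hM⟩ := iInf_lt_iff.1 hM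
  obtain ⟨h, hM⟩ := iInf_lt_iff.1 hM
  refine h.neg_two_mul_integral_le hΩ (A := fun _ => {v | IsSBV Ω v}) hη (fun k ε => ?_) hM
  exact (h.sbv2 k).sbv.perturb hΩ (IsTestFunction.zero.const_mul ε) (hη.const_mul ε) (by simp)

/-- The field `2 φ G + v ∇φ - ∇η`, against which `∫ φ |G|² + v G · ∇φ - G · ∇η` is linearized
at `G`. -/
noncomputable def linearizedField (G : Plane → Plane) (φ η v : Plane → ℝ) : Plane → Plane :=
  fun x => (2 : ℝ) • φ x • G x + v x • gradient φ x - gradient η x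

theorem memLp_linearizedField {U : Set Plane} {G : Plane → Plane} {φ η v : Plane → ℝ}
    (hG : MemLp G 2 (volume.restrict Ω)) (hφ : IsTestFunction U φ) (hη : IsTestFunction U η)
    (hv : MemLp v 2 (volume.restrict Ω)) :
    MemLp (linearizedField G φ η v) 2 (volume.restrict Ω) :=
  (((hφ.memLp_smul hG).const_smul (2 : ℝ)).add (hφ.memLp_smul_gradient hv)).sub
    (hη.memLp_gradient Ω 2)

theorem integral_inner_linearizedField_self {U : Set Plane} {G : Plane → Plane}
    {φ η v : Plane → ℝ} (hG : MemLp G 2 (volume.restrict Ω)) (hφ : IsTestFunction U φ)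
    (hη : IsTestFunction U η) (hv : MemLp v 2 (volume.restrict Ω)) :
    ∫ x in Ω, ⟪G x, linearizedField G φ η v x⟫
      = 2 * (∫ x in Ω, ‖G x‖ ^ 2 * φ x) + (∫ x in Ω, ⟪v x • G x, gradient φ x⟫)
        - ∫ x in Ω, ⟪G x, gradient η x⟫ := by
  have e1 : ∀ x, ⟪G x, φ x • G x⟫ = ‖G x‖ ^ 2 * φ x := fun x => by
    rw [inner_smul_right, real_inner_self_eq_norm_sq, mul_comm]
  have e2 : ∀ x, ⟪G x, v x • gradient φ x⟫ = ⟪v x • G x, gradient φ x⟫ := fun x => by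
    rw [inner_smul_right, real_inner_smul_left]
  have i1 := integrable_inner_of_memLp hG (hφ.memLp_smul hG)
  have i2 := integrable_inner_of_memLp hG (hφ.memLp_smul_gradient hv)
  have i3 := integrable_inner_of_memLp hG (hη.memLp_gradient Ω 2)
  simp only [e1] at i1
  simp only [e2] at i2
  have i4 : Integrable (fun x => 2 * (‖G x‖ ^ 2 * φ x) + ⟪v x • G x, gradient φ x⟫)
      (volume.restrict Ω) := (i1.const_mul 2).add i2
  rw [← integral_const_mul, ← integral_add (i1.const_mul 2) i2, ← integral_sub i4 i3]
  refine integral_congr_ae (ae_of_all _ fun x => ?_)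
  simp only [← e1, ← e2, linearizedField, inner_sub_right, inner_add_right,
    inner_smul_right (G x) _ (2 : ℝ)]

/-- Pointwise this is φ|G' - G|² ≥ 0, that is, the convex term φ|G'|² lies above its tangent at G.
The left side is affine in G', which weak convergence can handle. -/
theorem integral_inner_linearizedField_sub_le {U : Set Plane} {G G' : Plane → Plane}
    {φ η v : Plane → ℝ} (hG : MemLp G 2 (volume.restrict Ω)) (hG' : MemLp G' 2 (volume.restrict Ω))
    (hφ : IsTestFunction U φ) (hη : IsTestFunction U η) (hφ0 : ∀ x, 0 ≤ φ x)
    (hv : MemLp v 2 (volume.restrict Ω)) :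
    (∫ x in Ω, ⟪G' x, linearizedField G φ η v x⟫) - (∫ x in Ω, ‖G x‖ ^ 2 * φ x)
      ≤ -∫ x in Ω, ⟪G' x, incrementGrad v G' (fun x => -1 * φ x) η x⟫ := by
  have i1 := integrable_inner_of_memLp hG (hφ.memLp_smul hG)
  have e1 : ∀ x, ⟪G x, φ x • G x⟫ = ‖G x‖ ^ 2 * φ x := fun x => by
    rw [inner_smul_right, real_inner_self_eq_norm_sq, mul_comm]
  simp only [e1] at i1
  have i2 := integrable_inner_of_memLp hG' (memLp_linearizedField hG hφ hη hv)
  have i3 := integrable_inner_of_memLp hG'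
    (memLp_incrementGrad (hφ.const_mul (-1)) hη hv hG')
  rw [← integral_sub i2 i1, ← integral_neg]
  refine integral_mono (i2.sub i1) i3.neg fun x => ?_
  have e3 : incrementGrad v G' (fun x => -1 * φ x) η x
      = -(φ x • G' x + v x • gradient φ x - gradient η x) := by
    simp only [incrementGrad, gradient_const_mul_apply (-1) (hφ.differentiable x)]
    module
  have e4 : 0 ≤ φ x * ‖G' x - G x‖ ^ 2 := mul_nonneg (hφ0 x) (sq_nonneg _)
  rw [norm_sub_sq_real] at e4
  simp only [e3, linearizedField, inner_neg_right, inner_sub_right, inner_add_right,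
    inner_smul_right, real_inner_self_eq_norm_sq]
  linarith

theorem AdmissibleSequence.tendsto_normL2_sub_mul (h : AdmissibleSequence Ω u S uk Sk)
    (hu : MemLp u 2 (volume.restrict Ω)) {U : Set Plane} {φ η : Plane → ℝ}
    (hφ : IsTestFunction U φ) (hη : IsTestFunction U η) :
    Tendsto (fun k => (normL2 Ω (fun x => η x - φ x * uk k x)).toReal) atTop
      (𝓝 (normL2 Ω (fun x => η x - φ x * u x)).toReal) := by
  refine tendsto_normL2_toReal
    (fun k => (hη.memLp Ω 2).sub (hφ.memLp_smul (h.sbv2 k).memLp))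
    ((hη.memLp Ω 2).sub (hφ.memLp_smul hu)) ?_
  obtain ⟨D, hD0, hD⟩ := hφ.exists_bound
  refine squeeze_zero (fun k => ENNReal.toReal_nonneg) (fun k =>
    normL2_toReal_le_mul hD0 (h.memLp_sub hu k) fun x => ?_)
    (by simpa using h.tendsto_toReal.const_mul D)
  rw [sub_sub_sub_cancel_left, ← mul_sub, norm_mul, norm_sub_rev]
  gcongr
  exact hD x

/-- With G fixed, the field depends on k only through u_k∇φ, which converges strongly; it is paired
with the weakly convergent ∇u_k. -/
theorem AdmissibleSequence.tendsto_integral_linearizedField (h : AdmissibleSequence Ω u S uk Sk)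
    (hu : MemLp u 2 (volume.restrict Ω)) {U : Set Plane} {φ η : Plane → ℝ}
    (hφ : IsTestFunction U φ) (hη : IsTestFunction U η) {G : Plane → Plane}
    (hG : MemLp G 2 (volume.restrict Ω)) :
    Tendsto (fun k => ∫ x in Ω, ⟪approxGrad Ω (uk k) x, linearizedField G φ η (uk k) x⟫) atTop
      (𝓝 (∫ x in Ω, ⟪approxGrad Ω u x, linearizedField G φ η u x⟫)) := by
  refine h.weak_grad.tendsto_integral_inner
    (fun k => memLp_linearizedField hG hφ hη (h.sbv2 k).memLp)
    (memLp_linearizedField hG hφ hη hu) ?_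
  obtain ⟨D, hD0, hD⟩ := hφ.exists_bound_gradient
  refine squeeze_zero (fun k => ENNReal.toReal_nonneg) (fun k =>
    normL2_toReal_le_mul hD0 (h.memLp_sub hu k) fun x => ?_)
    (by simpa using h.tendsto_toReal.const_mul D)
  rw [linearizedField, linearizedField, sub_sub_sub_cancel_right, add_sub_add_left_eq_sub,
    ← sub_smul, norm_smul, mul_comm]
  gcongr
  exact hD x

theorem AdmissibleSequence.integral_sq_add_le (hΩ : IsOpen Ω) (hu : IsSBV2 Ω S u)
    (h : AdmissibleSequence Ω u S uk Sk) {φ η : Plane → ℝ} (hφ : IsTestFunction Ω φ)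
    (hη : IsTestFunction Ω η) (hφ0 : ∀ x, 0 ≤ φ x) {M : ℝ≥0}
    (hM : liminf (fun k => unilateralSlopeB Ω (uk k) (Sk k)) atTop < M) :
    (∫ x in Ω, ‖approxGrad Ω u x‖ ^ 2 * φ x)
        + (∫ x in Ω, ⟪u x • approxGrad Ω u x, gradient φ x⟫)
      ≤ (∫ x in Ω, ⟪approxGrad Ω u x, gradient η x⟫)
        + M / 2 * (normL2 Ω (fun x => η x - φ x * u x)).toReal := by
  have hfreq := frequently_lt_of_liminf_lt (by isBoundedDefault) hM
  have key := le_of_tendsto_of_tendsto_of_frequently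
    ((h.tendsto_integral_linearizedField hu.memLp hφ hη hu.memLp_grad).sub_const
      (∫ x in Ω, ‖approxGrad Ω u x‖ ^ 2 * φ x))
    ((h.tendsto_normL2_sub_mul hu.memLp hφ hη).const_mul ((M : ℝ) / 2))
    (hfreq.mono fun k hk => ?_)
  -- Linearizing at the limit gradient makes the tangent exact: twice ∫φ|∇u|² minus the subtracted
  -- constant leaves it once.
  · rw [integral_inner_linearizedField_self hu.memLp_grad hφ hη hu.memLp] at key
    linarith
  -- The direction is η - φu_k; the minus sign puts ∫φ|∇u_k|² on the smaller side of the inequality.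
  · have hφ' := hφ.const_mul (-1)
    have h1 := neg_two_mul_integral_le_of_limsup_le hΩ (h.hausdorffMeasure_lt_top k) (h.sbv2 k)
      (hφ'.mono (subset_univ Ω)) (hη.mono (subset_univ Ω))
      (A := {v | IsSBV Ω v ∧ EqOnBoundary Ω v (uk k)})
      (fun ε hε => ⟨(h.sbv2 k).sbv.perturb hΩ ((hφ'.const_mul ε).mono (subset_univ Ω))
          ((hη.const_mul ε).mono (subset_univ Ω)) hε,
        eqOnBoundary_perturb hΩ (hφ'.const_mul ε) (hη.const_mul ε)⟩) hk.le
    have e1 : (fun x => -1 * φ x * uk k x + η x) = fun x => η x - φ x * uk k x := by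
      funext x
      ring
    rw [e1] at h1
    have h2 := integral_inner_linearizedField_sub_le hu.memLp_grad (h.sbv2 k).memLp_grad hφ hη
      hφ0 (h.sbv2 k).memLp
    linarith

end RelaxedSlope

/-! ### Differential inequality, extension by zero and conclusion. -/

theorem le_integral_mul_of_forall_test {Ω : Set Plane} (hΩ : IsOpen Ω) {f ψ : Plane → ℝ}
    (hf : MemLp f 2 (volume.restrict Ω)) (hψ : MemLp ψ 2 (volume.restrict Ω)) {L C : ℝ}
    (hC : 0 ≤ C)
    (h : ∀ η, IsTestFunction Ω η →
      L ≤ (∫ x in Ω, f x * η x) + C * (normL2 Ω (fun x => η x - ψ x)).toReal) :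
    L ≤ ∫ x in Ω, f x * ψ x := by
  set N := (normL2 Ω f).toReal
  have hN : 0 ≤ N := ENNReal.toReal_nonneg
  refine le_of_forall_pos_le_add fun ε hε => ?_
  obtain ⟨η, hη, hlt⟩ := exists_test_normL2_sub_lt hΩ hψ
    -- Replacing η by ψ costs at most (N + C)‖η - ψ‖; the added 1 keeps the denominator positive.
    (show 0 < ε / (N + C + 1) by positivity)
  have hη2 := hη.memLp Ω 2
  have hd : MemLp (fun x => η x - ψ x) 2 (volume.restrict Ω) := hη2.sub hψ
  have hsymm : normL2 Ω (fun x => η x - ψ x) = normL2 Ω (fun x => ψ x - η x) :=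
    eLpNorm_sub_comm η ψ 2 _
  have h1 := (le_abs_self _).trans (abs_integral_inner_le hf hd)
  have h2 : ∫ x in Ω, ⟪f x, η x - ψ x⟫ = (∫ x in Ω, f x * η x) - ∫ x in Ω, f x * ψ x := by
    have i1 := integrable_inner_of_memLp hf hη2
    have i2 := integrable_inner_of_memLp hf hψ
    rw [← integral_inner_real, ← integral_inner_real, ← integral_sub i1 i2]
    simp only [inner_sub_right]
  rw [h2] at h1
  have h3 := h η hη
  rw [hsymm] at h3
  change _ ≤ N * (normL2 Ω (fun x => η x - ψ x)).toReal at h1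
  rw [hsymm] at h1
  have h4 : (normL2 Ω (fun x => ψ x - η x)).toReal * (N + C + 1) < ε :=
    (lt_div_iff₀ (by positivity)).1 hlt
  have h5 : 0 ≤ (normL2 Ω (fun x => ψ x - η x)).toReal := ENNReal.toReal_nonneg
  linarith

theorem subDivLe_of_negDivEq {Ω S : Set Plane} (hΩ : IsOpen Ω) {u f : Plane → ℝ}
    (hu : IsSBV2 Ω S u) (hr : relaxedSlopeB Ω u S < ∞) (hf : MemLp f 2 (volume.restrict Ω))
    (hdiv : NegDivEq Ω (approxGrad Ω u) f) :
    SubDivLe Ω (fun x => ‖approxGrad Ω u x‖ ^ 2) (fun x => u x • approxGrad Ω u x)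
      (fun x => f x * u x) := by
  intro φ hφ hφ0
  -- Any finite M above the relaxed slope will do: its term disappears as η → φu.
  obtain ⟨M, hM, -⟩ := ENNReal.lt_iff_exists_nnreal_btwn.1 hr
  obtain ⟨uk, hM⟩ := iInf_lt_iff.1 hM
  obtain ⟨Sk, hM⟩ := iInf_lt_iff.1 hM
  obtain ⟨h, hM⟩ := iInf_lt_iff.1 hM
  have e : ∀ x, f x * u x * φ x = f x * (φ x * u x) := fun x => by ring
  simp only [e]
  refine le_integral_mul_of_forall_test hΩ hf (hφ.memLp_smul hu.memLp)
    (div_nonneg M.coe_nonneg zero_le_two) fun η hη => ?_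
  rw [← hdiv η hη]
  exact h.integral_sq_add_le hΩ hu hφ hη hφ0 hM

theorem negDivEq_univ_indicator {Ω S : Set Plane} (hΩ : IsOpen Ω) {u f : Plane → ℝ}
    (hu : IsSBV2 Ω S u) (hr : relaxedSlope Ω u S < ∞) (hf : MemLp f 2 (volume.restrict Ω))
    (hdiv : NegDivEq Ω (approxGrad Ω u) f) :
    NegDivEq univ (Ω.indicator (approxGrad Ω u)) (Ω.indicator f) := by
  obtain ⟨f', hf', -, hdiv'⟩ := exists_negDiv_of_bound hu.memLp_grad
    (div_nonneg ENNReal.toReal_nonneg zero_le_two)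
    (fun φ hφ => abs_integral_inner_gradient_le_relaxedSlope hΩ hr hφ)
  -- Test functions supported in Ω are admissible in both equations and determine an L² function on
  -- Ω.
  have hff' : f' - f =ᵐ[volume.restrict Ω] 0 := by
    refine ae_eq_zero_of_integral_mul_test hΩ (hf'.sub hf) fun φ hφ => ?_
    have i1 := integrable_inner_of_memLp hf' (hφ.memLp Ω 2)
    have i2 := integrable_inner_of_memLp hf (hφ.memLp Ω 2)
    have e1 := hdiv φ hφ
    rw [hdiv' φ (hφ.mono (subset_univ Ω)), ← integral_inner_real, ← integral_inner_real] at e1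
    rw [← integral_inner_real]
    simp only [Pi.sub_apply, inner_sub_left]
    rw [integral_sub i1 i2, e1, sub_self]
  intro φ hφ
  have e1 : ∀ x, ⟪Ω.indicator (approxGrad Ω u) x, gradient φ x⟫
      = Ω.indicator (fun x => ⟪approxGrad Ω u x, gradient φ x⟫) x := fun x => by
    by_cases hx : x ∈ Ω <;> simp [hx]
  have e2 : ∀ x, Ω.indicator f x * φ x = Ω.indicator (fun x => f x * φ x) x := fun x => by
    by_cases hx : x ∈ Ω <;> simp [hx]
  simp only [e1, e2, Measure.restrict_univ, integral_indicator hΩ.measurableSet]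
  rw [hdiv' φ hφ]
  refine integral_congr_ae ?_
  filter_upwards [hff'] with x hx
  rw [sub_eq_zero.1 hx]

end MumfordShah

theorem proposition3 (Ω : Set Plane) (hΩ_open : IsOpen Ω) (hΩ_bounded : Bornology.IsBounded Ω)
    (hΩ_C1 : HasC1Boundary Ω) (S : Set Plane) (hS : S ⊆ Ω)
    (hS_finite : (Measure.hausdorffMeasure 1 : Measure Plane) S < ∞)
    (u : Plane → ℝ) (hu : IsSBV2 Ω S u) (hslope : relaxedSlopeB Ω u S < ∞) :
    ∃ f : Plane → ℝ, MemLp f 2 (volume.restrict Ω) ∧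
      NegDivEq Ω (approxGrad Ω u) f ∧
      SubDivLe Ω (fun x => ‖approxGrad Ω u x‖ ^ 2) (fun x => u x • approxGrad Ω u x)
        (fun x => f x * u x) ∧
      2 * normL2 Ω f ≤ relaxedSlopeB Ω u S ∧
      (relaxedSlope Ω u S < ∞ →
        NegDivEq univ (Ω.indicator (approxGrad Ω u)) (Ω.indicator f)) := by
  obtain ⟨f, hf, hfn, hdiv⟩ := exists_negDiv_of_bound hu.memLp_grad
    (div_nonneg ENNReal.toReal_nonneg zero_le_two)
    (fun φ hφ => abs_integral_inner_gradient_le_relaxedSlopeB hΩ_open hslope hφ)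
  refine ⟨f, hf, hdiv, subDivLe_of_negDivEq hΩ_open hu hslope hf hdiv, ?_,
    fun hr => negDivEq_univ_indicator hΩ_open hu hr hf hdiv⟩
  calc 2 * normL2 Ω f ≤ 2 * ENNReal.ofReal ((relaxedSlopeB Ω u S).toReal / 2) := by gcongr
    _ = relaxedSlopeB Ω u S := by
      rw [← ENNReal.ofReal_ofNat 2, ← ENNReal.ofReal_mul zero_le_two,
        mul_div_cancel₀ _ two_ne_zero, ENNReal.ofReal_toReal hslope.ne]
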